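/- Let $(X,\mathcal B,\mu)$ be a standard Borel probability space, let $\Gamma$ be a group generated by a finite nonempty symmetric set $S$, and let $\Gamma$ act on $X$ by $\mu$-preserving Borel isomorphisms. For a symmetric probability measure $\lambda$ on $\Gamma$ let $M_\lambda$ be the averaging operator $(M_\lambda f)(x)=\sum_{g}\lambda(g)f(gx)$. For a subgroup $K\le\Gamma$ and a $K$-invariant (modulo null sets) Borel set $Y$ of positive measure, and $\lambda$ supported on $K$, let $$\rho^+(Y,\lambda)=\sup_{0\ne f\in L^2_0(Y)}\frac{\langle M_\lambda f,f\rangle}{\langle f,f\rangle},$$ where $L_0^2(Y)$ consists of the square integrable real functions on $(Y,\mu|_Y/\mu(Y))$ with zero integral (and $\sup\emptyset=0$). We say that $K$ acts on $Y$ with spectral gap if $\rho^+(Y,\lambda)<1$ for every symmetric probability measure $\lambda$ whose support generates $K$. An ergodic component of $K$ is a $K$-invariant (modulo null sets) Borel set of positive measure in which every $K$-invariant Borel subset is null or conull. Let $\lambda_S$ be the uniform probability measure on $S$, let $\lambda'=\frac12\lambda_S+\frac12\delta_e$ be its lazy version, and let $\lambda'_n$ be the law of the $\lambda'$-random walk on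 $\Gamma$ after $n$ steps, started at $e$. For a subgroup $H\le\Gamma$ let $$\rho(\Gamma,H,\lambda_S)=\sup_{0\neq f\in \ell^2(\Gamma/H)}\frac{\langle M_{\lambda_S}f,f\rangle}{\langle f,f\rangle}$$ be the relative spectral radius, where $M_{\lambda_S}$ acts on real functions on the coset space by the same formula. **Theorem.** Let $H\le\Gamma$ be a subgroup with $\rho(\Gamma,H,\lambda_S)>\rho^+(X,\lambda_S)$. Then there is an even $n\geq 0$ with $\lambda'_n(H)>\rho^+(X,\lambda')^n$. Moreover, for every $n\geq 0$ with $\lambda'_n(H)>\rho^+(X,\lambda')^n$, the subgroup $H'\le H$ generated by $H\cap\operatorname{supp}\lambda'_n$ is finitely generated, $X$ is a disjoint union of finitely many ergodic components of $H'$, and $H'$ acts on each of these components with spectral gap. In particular, some finitely generated subgroup of $H$ has finitely many ergodic components on $X$ and acts on each of them with spectral gap. -/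

import Mathlib

open MeasureTheory

noncomputable section

namespace SpectralAction

/-- A probability measure `p` on a (countable) group is symmetric if it is invariant under
inversion. -/
def IsSymmetric {Γ : Type*} [Group Γ] (p : PMF Γ) : Prop :=
  ∀ g : Γ, p g⁻¹ = p g

/-- The lazy version `½ p + ½ δ_e` of a probability measure `p` on a group. -/
def lazy {Γ : Type*} [Group Γ] (p : PMF Γ) : PMF Γ :=
  (PMF.uniformOfFintype Bool).bind fun b => if b then p else PMF.pure 1

/-- The law after `n` steps of the `p`-random walk started at the identity, that is, the `n`-fold
convolution power of `p`. -/
def walk {Γ : Type*} [Group Γ] (p : PMF Γ) : ℕ → PMF Γ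
  | 0 => PMF.pure 1
  | n + 1 => (walk p n).bind fun g => p.map fun s => g * s

/-- The probability that the `p`-random walk of length `n` started at the identity ends in `H`. -/
def returnProb {Γ : Type*} [Group Γ] (p : PMF Γ) (H : Subgroup Γ) (n : ℕ) : ℝ :=
  ∑' h : H, (walk p n h).toReal

/-- The averaging operator `(M_p f)(x) = ∑_g p(g) f(g x)` of a probability measure on a group `Γ`
acting on a set `A`, on real functions on `A`. -/
def avg {Γ A : Type*} [Group Γ] [MulAction Γ A] (p : PMF Γ) (f : A → ℝ) (x : A) : ℝ :=
  ∑' g : Γ, (p g).toReal * f (g • x)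

/-- The relative spectral radius `ρ(Γ, H, p)`: the supremum of `⟨M_p f, f⟩ / ⟨f, f⟩` over nonzero
square summable functions `f` on the coset space of `H` in `Γ`. -/
def relSpectralRadius {Γ : Type*} [Group Γ] (H : Subgroup Γ) (p : PMF Γ) : ℝ :=
  sSup {r : ℝ | ∃ f : Γ ⧸ H → ℝ, Memℓp f 2 ∧ f ≠ 0 ∧
    r = (∑' c, avg p f c * f c) / ∑' c, f c ^ 2}

/-- The top of the spectrum `ρ⁺(X, ν, p)`: the supremum of `⟨M_p f, f⟩ / ⟨f, f⟩` over nonzero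
`f ∈ L²₀(X, ν)`, the square integrable real functions with zero integral. -/
def topSpectrum {Γ X : Type*} [Group Γ] [MulAction Γ X] [MeasurableSpace X]
    (ν : Measure X) (p : PMF Γ) : ℝ :=
  sSup {r : ℝ | ∃ f : X → ℝ, MemLp f 2 ν ∧ ∫ x, f x ∂ν = 0 ∧ ¬ f =ᵐ[ν] 0 ∧
    r = (∫ x, avg p f x * f x ∂ν) / ∫ x, f x ^ 2 ∂ν}

/-- The Borel set `Y` is invariant (modulo `μ`-null sets) under the subgroup `K`. -/
def IsInvariant {Γ X : Type*} [Group Γ] [MulAction Γ X] [MeasurableSpace X]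
    (μ : Measure X) (K : Subgroup Γ) (Y : Set X) : Prop :=
  MeasurableSet Y ∧ ∀ g ∈ K, (fun x : X => g • x) ⁻¹' Y =ᵐ[μ] Y

/-- `Y` is an ergodic component of the subgroup `K`: an invariant Borel set of positive measure
in which every invariant Borel subset is null or conull. -/
def IsErgodicComponent {Γ X : Type*} [Group Γ] [MulAction Γ X] [MeasurableSpace X]
    (μ : Measure X) (K : Subgroup Γ) (Y : Set X) : Prop :=
  IsInvariant μ K Y ∧ 0 < μ Y ∧
    ∀ Z : Set X, Z ⊆ Y → IsInvariant μ K Z → μ Z = 0 ∨ μ (Y \ Z) = 0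

/-- The (countable) subgroup `K` acts with spectral gap on the `K`-invariant set `Y` of positive
measure, with the normalized restriction of `μ`: one has `ρ⁺(Y, p) < 1` for every symmetric
probability measure `p` whose support generates `K`. (One such `p` satisfies this if and only if
all do.) -/
def HasSpectralGapOn {Γ X : Type*} [Group Γ] [MulAction Γ X] [MeasurableSpace X]
    (μ : Measure X) (K : Subgroup Γ) (Y : Set X) : Prop :=
  ∀ p : PMF Γ, IsSymmetric p → Subgroup.closure p.support = K →
    topSpectrum (ProbabilityTheory.cond μ Y) p < 1

/-- `X` is the disjoint union of finitely many ergodic components of `K`, and `K` acts on each of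
them with spectral gap. -/
def FinitelyManyComponentsWithGap {Γ X : Type*} [Group Γ] [MulAction Γ X] [MeasurableSpace X]
    (μ : Measure X) (K : Subgroup Γ) : Prop :=
  ∃ (m : ℕ) (Y : Fin m → Set X), Pairwise (fun i j => Disjoint (Y i) (Y j)) ∧
    (⋃ i, Y i) = Set.univ ∧
    ∀ i, IsErgodicComponent μ K (Y i) ∧ HasSpectralGapOn μ K (Y i)

/-- The subgroup generated by the support of the `n`-step law of the `p`-random walk restricted
to `H`. -/
def walkSubgroup {Γ : Type*} [Group Γ] (p : PMF Γ) (H : Subgroup Γ) (n : ℕ) : Subgroup Γ :=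
  Subgroup.closure ((H : Set Γ) ∩ (walk p n).support)

end SpectralAction

end

/-! Write `ρ` for the top of the spectrum of the lazy walk on `X`. Laziness makes the averaging
operator positive, so on mean-zero functions `ρ` bounds its norm and `ρ ^ n` bounds the norm of its
`n`-th power.

Existence of `n` is proved by contraposition. On the coset space, the return probability to `H` at
time `2n` is `‖M ^ n δ‖²` for the point mass `δ` at the trivial coset. If all even return
probabilities are at most `ρ ^ n`, this decay passes from `δ` to its translates, because one step of
the walk dominates each translation by a generator, and then to their dense span. For a symmetric
operator such decay forces `‖M x‖ ≤ ρ ‖x‖` (`norm_apply_le_of_norm_pow_apply_le`). Undoing laziness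
bounds the relative spectral radius by `2ρ - 1`, which is at most the top of the spectrum of the
original walk on `X`, against the hypothesis (`relSpectralRadius_le_of_return_le`,
`topSpectrum_lazy_le`).

For the second half put `c = λ'_n(H) - ρ ^ n > 0`. Estimating the average of `⟨g v, v⟩` over the
walk from above by the spectrum, and from below by the terms in `H`, gives for all `v ≥ 0` the
inequality `c ‖v‖² ≤ (∫ v)² + ∑ ‖h v - v‖²`, summed over the finitely many `h` in `H` that the walk
reaches (`sub_mul_integral_sq_le`). Indicators of invariant sets then show that these have measure
zero or at least `c`, so there are finitely many ergodic components.

Suppose a component has no gap; it carries almost invariant mean-zero unit vectors. The inequality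
makes their large values negligible, so they can be truncated and rescaled into `[0, 1]` with
variance bounded away from zero (`AlmostInvariant.false_of_unit`). By ergodicity an almost invariant
sequence is asymptotically independent of any fixed function, so products of well chosen terms are
almost invariant with moments near `α ^ j` and `β ^ j`. The inequality becomes `c β ^ j ≤ α ^ (2j)`
for all `j`, hence `β ≤ α²` and the variance vanishes, a contradiction
(`AlmostInvariant.second_moment_le`). -/

noncomputable section

namespace SpectralAction

/-! ### Expectations of functions on a group -/

section Expectation

variable {Γ : Type*}

/-- The expectation of a real function under a discrete probability measure. -/
def expect (p : PMF Γ) (φ : Γ → ℝ) : ℝ := ∑' g, (p g).toReal * φ g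

lemma hasSum_toReal (p : PMF Γ) : HasSum (fun g => (p g).toReal) 1 := by
  have h := ENNReal.hasSum_toReal (f := p) (by simp [p.tsum_coe])
  rwa [← ENNReal.tsum_toReal_eq (fun a => p.apply_ne_top a), p.tsum_coe, ENNReal.toReal_one] at h

lemma summable_expect_of_finite {p : PMF Γ} (hp : p.support.Finite) (φ : Γ → ℝ) :
    Summable fun g => (p g).toReal * φ g :=
  summable_of_hasFiniteSupport <| hp.subset fun g hg => by
    rw [PMF.mem_support_iff]
    rintro h
    simp [h] at hg

lemma expect_eq_sum {p : PMF Γ} {T : Finset Γ} (hT : p.support ⊆ T) (φ : Γ → ℝ) :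
    expect p φ = ∑ g ∈ T, (p g).toReal * φ g := by
  refine tsum_eq_sum fun g hg => ?_
  have : p g = 0 := by
    rw [PMF.apply_eq_zero_iff]
    exact fun h => hg (hT h)
  simp [this]

lemma expect_const (p : PMF Γ) (c : ℝ) : expect p (fun _ => c) = c := by
  rw [expect, tsum_mul_right, (hasSum_toReal p).tsum_eq, one_mul]

lemma expect_bind {p : PMF Γ} {q : Γ → PMF Γ} (hp : p.support.Finite)
    (hq : ∀ a, (q a).support.Finite) (φ : Γ → ℝ) :
    expect (p.bind q) φ = expect p fun a => expect (q a) φ := by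
  classical
  set A := hp.toFinset
  set T := A.biUnion fun a => (hq a).toFinset
  have hA : p.support ⊆ A := by simp [A]
  have hT : (p.bind q).support ⊆ T := by
    intro g hg
    simpa [T, A, PMF.mem_support_bind_iff] using hg
  have hqT : ∀ a ∈ A, (q a).support ⊆ T := fun a ha g hg => by
    simp only [T, Finset.coe_biUnion, Set.mem_iUnion]
    exact ⟨a, ha, by simpa using hg⟩
  rw [expect_eq_sum hT, expect_eq_sum hA]
  have h1 : ∀ g, ((p.bind q) g).toReal = ∑ a ∈ A, (p a).toReal * (q a g).toReal := by
    intro g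
    rw [PMF.bind_apply, tsum_eq_sum (s := A), ENNReal.toReal_sum]
    · simp
    · exact fun a _ => ENNReal.mul_ne_top (p.apply_ne_top a) ((q a).apply_ne_top g)
    · intro a ha
      have : p a = 0 := by
        rw [PMF.apply_eq_zero_iff]
        exact fun h => ha (hA h)
      simp [this]
  simp_rw [h1, Finset.sum_mul]
  rw [Finset.sum_comm]
  refine Finset.sum_congr rfl fun a ha => ?_
  rw [expect_eq_sum (hqT a ha), Finset.mul_sum]
  exact Finset.sum_congr rfl fun g _ => by ring

lemma expect_pure (a : Γ) (φ : Γ → ℝ) : expect (PMF.pure a) φ = φ a := by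
  rw [expect_eq_sum (T := {a}) (by simp)]
  simp

lemma expect_map {p : PMF Γ} (hp : p.support.Finite) (k : Γ → Γ) (φ : Γ → ℝ) :
    expect (p.map k) φ = expect p fun a => φ (k a) := by
  rw [PMF.map, expect_bind hp (fun a => by simp)]
  simp [expect_pure]

lemma expect_uniformOfFinset (S : Finset Γ) (hne : S.Nonempty) (φ : Γ → ℝ) :
    expect (PMF.uniformOfFinset S hne) φ = (S.card : ℝ)⁻¹ * ∑ s ∈ S, φ s := by
  rw [expect_eq_sum (T := S) (by simp), Finset.mul_sum]
  exact Finset.sum_congr rfl fun s hs => by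
    simp [PMF.uniformOfFinset_apply_of_mem hne hs]

variable [Group Γ]

lemma lazy_apply_toReal (p : PMF Γ) (g : Γ) :
    (lazy p g).toReal = 2⁻¹ * (p g).toReal + 2⁻¹ * (PMF.pure (1 : Γ) g).toReal := by
  rw [lazy, PMF.bind_apply, tsum_bool, ENNReal.toReal_add]
  · by_cases hg : g = 1 <;> simp [hg, add_comm]
  all_goals exact ENNReal.mul_ne_top (PMF.apply_ne_top _ _) (PMF.apply_ne_top _ _)

lemma lazy_support (p : PMF Γ) : (lazy p).support = p.support ∪ {1} := by
  ext g
  simp [lazy]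

lemma expect_lazy {p : PMF Γ} {φ : Γ → ℝ} (h : Summable fun g => (p g).toReal * φ g) :
    expect (lazy p) φ = 2⁻¹ * expect p φ + 2⁻¹ * φ 1 := by
  have h1 : ∀ g, (lazy p g).toReal * φ g =
      2⁻¹ * ((p g).toReal * φ g) + 2⁻¹ * ((PMF.pure (1 : Γ) g).toReal * φ g) := fun g => by
    rw [lazy_apply_toReal]; ring
  rw [expect, tsum_congr h1, Summable.tsum_add (h.mul_left _)
    ((summable_expect_of_finite (by simp) φ).mul_left _), tsum_mul_left, tsum_mul_left]
  congr 2
  exact expect_pure 1 φ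

lemma walk_support_finite {p : PMF Γ} (hp : p.support.Finite) (n : ℕ) :
    (walk p n).support.Finite := by
  induction n with
  | zero => simp [walk]
  | succ n ih =>
    rw [walk, PMF.support_bind]
    refine ih.biUnion fun a _ => ?_
    rw [PMF.support_map]
    exact hp.image _

lemma expect_walk_succ {p : PMF Γ} (hp : p.support.Finite) (n : ℕ) (φ : Γ → ℝ) :
    expect (walk p (n + 1)) φ = expect (walk p n) fun a => expect p fun s => φ (a * s) := by
  rw [walk, expect_bind (walk_support_finite hp n)
    (fun a => by rw [PMF.support_map]; exact hp.image _)]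
  simp_rw [expect_map hp]

lemma returnProb_eq_sum {p : PMF Γ} (H : Subgroup Γ) {n : ℕ} {T : Finset Γ}
    (hT : ∀ g, g ∈ T ↔ g ∈ H ∧ g ∈ (walk p n).support) :
    returnProb p H n = ∑ g ∈ T, (walk p n g).toReal := by
  classical
  change ∑' h : (H : Set Γ), (walk p n h).toReal = _
  rw [tsum_subtype (s := (H : Set Γ)) (fun g => (walk p n g).toReal),
    tsum_eq_sum (s := T)]
  · exact Finset.sum_congr rfl fun g hg => Set.indicator_of_mem ((hT g).1 hg).1 _
  · intro g hg
    by_cases hgH : g ∈ H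
    · have : walk p n g = 0 := by
        rw [PMF.apply_eq_zero_iff]
        exact fun h => hg ((hT g).2 ⟨hgH, h⟩)
      simp [this]
    · exact Set.indicator_of_notMem hgH _

open Classical in
lemma returnProb_eq_expect (p : PMF Γ) (H : Subgroup Γ) (n : ℕ) :
    returnProb p H n = expect (walk p n) fun g => if g ∈ H then 1 else 0 := by
  change ∑' h : (H : Set Γ), (walk p n h).toReal = _
  rw [tsum_subtype (s := (H : Set Γ)) (fun g => (walk p n g).toReal)]
  exact tsum_congr fun g => by simp [Set.indicator_apply]

lemma countable_of_closure_eq_top {S : Finset Γ} (hS : Subgroup.closure (S : Set Γ) = ⊤) :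
    Countable Γ := by
  have h : (FreeGroup.lift (fun s : S => (s : Γ))).range = ⊤ := by
    rw [FreeGroup.range_lift_eq_closure, ← hS]
    congr 1
    exact Subtype.range_coe
  have : Countable (FreeGroup S) := inferInstanceAs (Countable (Quot _))
  exact (MonoidHom.range_eq_top.1 h).countable

end Expectation

/-! ### Symmetric operators on a Hilbert space -/

section Symmetric

variable {E : Type*} [NormedAddCommGroup E] [InnerProductSpace ℝ E]

open scoped InnerProductSpace

/-- Symmetry and Cauchy-Schwarz make `n ↦ ‖M ^ n x‖` log-convex, so successive ratios never
decrease. If the first ratio `r` exceeded `ρ`, the norms would grow at least like `r ^ n`. The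
constant `C` may depend on `x` and disappears from the conclusion. -/
lemma norm_apply_le_of_norm_pow_apply_le {M : E →L[ℝ] E}
    (hM : ∀ x y, ⟪M x, y⟫_ℝ = ⟪x, M y⟫_ℝ) {x : E} {C ρ : ℝ} (hρ : 0 ≤ ρ)
    (h : ∀ n, ‖(M ^ n) x‖ ≤ C * ρ ^ n) : ‖M x‖ ≤ ρ * ‖x‖ := by
  by_contra! hlt
  have hx : 0 < ‖x‖ := by
    rw [norm_pos_iff]
    rintro rfl
    simp at hlt
  set r := ‖M x‖ / ‖x‖
  have hr : ρ < r := by rwa [lt_div_iff₀ hx]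
  have hr0 : 0 < r := hρ.trans_lt hr
  have hcs : ∀ n, ‖(M ^ (n + 1)) x‖ ^ 2 ≤ ‖(M ^ n) x‖ * ‖(M ^ (n + 2)) x‖ := by
    intro n
    rw [← real_inner_self_eq_norm_sq]
    have : ⟪(M ^ (n + 1)) x, (M ^ (n + 1)) x⟫_ℝ = ⟪(M ^ n) x, (M ^ (n + 2)) x⟫_ℝ := by
      conv_lhs => rw [pow_succ' M n, mul_apply_eq_comp, hM]
      rw [pow_succ' M (n + 1), pow_succ' M n]
      rfl
    rw [this]
    exact real_inner_le_norm _ _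
  have key : ∀ n, 0 < ‖(M ^ n) x‖ ∧ r * ‖(M ^ n) x‖ ≤ ‖(M ^ (n + 1)) x‖ := by
    intro n
    induction n with
    | zero =>
      refine ⟨by simpa using hx, le_of_eq ?_⟩
      simp [r, hx.ne']
    | succ n ih =>
      have h1 : 0 < ‖(M ^ (n + 1)) x‖ := (mul_pos hr0 ih.1).trans_le ih.2
      refine ⟨h1, le_of_mul_le_mul_left ?_ ih.1⟩
      refine le_trans ?_ (hcs n)
      nlinarith [mul_le_mul_of_nonneg_right ih.2 h1.le]
  have hpow : ∀ n, r ^ n * ‖x‖ ≤ ‖(M ^ n) x‖ := by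
    intro n
    induction n with
    | zero => simp
    | succ n ih =>
      calc r ^ (n + 1) * ‖x‖ = r * (r ^ n * ‖x‖) := by ring
        _ ≤ r * ‖(M ^ n) x‖ := mul_le_mul_of_nonneg_left ih hr0.le
        _ ≤ _ := (key n).2
  have hle : ∀ n, ‖x‖ ≤ C * (ρ / r) ^ n := by
    intro n
    rw [div_pow, ← mul_div_assoc, le_div_iff₀ (pow_pos hr0 n), mul_comm]
    exact (hpow n).trans (h n)
  have hlim : Filter.Tendsto (fun n : ℕ => C * (ρ / r) ^ n) Filter.atTop (nhds (C * 0)) :=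
    (tendsto_pow_atTop_nhds_zero_of_lt_one (div_nonneg hρ hr0.le)
      ((div_lt_one hr0).2 hr)).const_mul C
  have := ge_of_tendsto' hlim hle
  linarith

/-- Positivity of the form at `x - t • M x` gives a quadratic inequality in `t`. Invariance of `V`
allows the form bound to be used at `M x` as well as at `x`. -/
lemma norm_apply_le_of_inner_le {M : E →L[ℝ] E}
    (hM : ∀ x y, ⟪M x, y⟫_ℝ = ⟪x, M y⟫_ℝ) (hpos : ∀ x, 0 ≤ ⟪M x, x⟫_ℝ)
    {V : Submodule ℝ E} (hV : ∀ x ∈ V, M x ∈ V) {ρ : ℝ} (hρ : 0 ≤ ρ)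
    (h : ∀ x ∈ V, ⟪M x, x⟫_ℝ ≤ ρ * ‖x‖ ^ 2) {x : E} (hx : x ∈ V) : ‖M x‖ ≤ ρ * ‖x‖ := by
  have key : ∀ t : ℝ, 0 ≤ ρ * ‖x‖ ^ 2 - 2 * t * ‖M x‖ ^ 2 + t ^ 2 * (ρ * ‖M x‖ ^ 2) := by
    intro t
    have h1 := hpos (x - t • M x)
    simp only [map_sub, map_smul, inner_sub_left, inner_sub_right, real_inner_smul_left,
      real_inner_smul_right] at h1
    rw [hM (M x) x, real_inner_self_eq_norm_sq] at h1
    have h2 := h x hx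
    have h3 := mul_le_mul_of_nonneg_left (h (M x) (hV x hx)) (sq_nonneg t)
    nlinarith
  refine (sq_le_sq₀ (norm_nonneg _) (by positivity)).1 ?_
  rw [mul_pow]
  rcases hρ.eq_or_lt with rfl | hρ
  · nlinarith [key 1]
  -- The value `t = ρ⁻¹` minimizes the quadratic.
  · have := key ρ⁻¹
    have h4 : ρ * (ρ * ‖x‖ ^ 2 - 2 * ρ⁻¹ * ‖M x‖ ^ 2 + ρ⁻¹ ^ 2 * (ρ * ‖M x‖ ^ 2))
        = ρ ^ 2 * ‖x‖ ^ 2 - ‖M x‖ ^ 2 := by field_simp; ring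
    nlinarith [mul_nonneg hρ.le this]

lemma norm_pow_apply_le {M : E →L[ℝ] E} {V : Submodule ℝ E} (hV : ∀ x ∈ V, M x ∈ V) {ρ : ℝ}
    (hρ : 0 ≤ ρ) (h : ∀ x ∈ V, ‖M x‖ ≤ ρ * ‖x‖) {x : E} (hx : x ∈ V) (n : ℕ) :
    ‖(M ^ n) x‖ ≤ ρ ^ n * ‖x‖ := by
  have : (M ^ n) x ∈ V ∧ ‖(M ^ n) x‖ ≤ ρ ^ n * ‖x‖ := by
    induction n with
    | zero => simpa using hx
    | succ n ih =>
      rw [pow_succ', mul_apply_eq_comp]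
      refine ⟨hV _ ih.1, (h _ ih.1).trans ?_⟩
      rw [pow_succ', mul_assoc]
      exact mul_le_mul_of_nonneg_left ih.2 hρ
  exact this.2

end Symmetric

lemma smul_nonneg_Lp {A : Type*} [MeasurableSpace A] {m : Measure A} {c : ℝ} (hc : 0 ≤ c)
    {f : Lp ℝ 2 m} (hf : 0 ≤ f) : 0 ≤ c • f := by
  rw [← Lp.coeFn_nonneg] at hf ⊢
  filter_upwards [hf, Lp.coeFn_smul c f] with x hx h
  rw [h]
  exact mul_nonneg hc hx

/-! ### The Koopman representation -/

section Koopman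

open scoped InnerProductSpace

variable {Γ A : Type*} [Group Γ] [MulAction Γ A] [MeasurableSpace A] [MeasurableConstSMul Γ A]
  (m : Measure A) [SMulInvariantMeasure Γ A m]

/-- The isometry `f ↦ f (g • ·)` of `L²` induced by an element of a group that acts by measure
preserving maps. -/
def koopman (g : Γ) : Lp ℝ 2 m →L[ℝ] Lp ℝ 2 m :=
  (Lp.compMeasurePreservingₗᵢ ℝ (g • ·) (measurePreserving_smul g m)).toContinuousLinearMap

variable {m}

lemma coeFn_koopman (g : Γ) (f : Lp ℝ 2 m) : koopman m g f =ᵐ[m] fun x => f (g • x) :=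
  Lp.coeFn_compMeasurePreserving f (measurePreserving_smul g m)

lemma norm_koopman (g : Γ) (f : Lp ℝ 2 m) : ‖koopman m g f‖ = ‖f‖ :=
  Lp.norm_compMeasurePreserving f (measurePreserving_smul g m)

lemma koopman_one (f : Lp ℝ 2 m) : koopman m (1 : Γ) f = f := by
  refine Lp.ext ?_
  filter_upwards [coeFn_koopman (1 : Γ) f] with x hx
  rw [hx, one_smul]

/-- Precomposition reverses the order of products. This fits `walk`, whose new increments are
multiplied on the right. -/
lemma koopman_mul (g h : Γ) (f : Lp ℝ 2 m) :
    koopman m (g * h) f = koopman m h (koopman m g f) := by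
  refine Lp.ext ?_
  filter_upwards [coeFn_koopman (g * h) f, coeFn_koopman h (koopman m g f),
    (measurePreserving_smul h m).quasiMeasurePreserving.ae (coeFn_koopman g f)] with x h1 h2 h3
  rw [h1, h2, h3, mul_smul]

lemma inner_koopman_left (g : Γ) (f f' : Lp ℝ 2 m) :
    ⟪koopman m g f, f'⟫_ℝ = ⟪f, koopman m g⁻¹ f'⟫_ℝ := by
  have h : f' = koopman m g (koopman m g⁻¹ f') := by
    rw [← koopman_mul, inv_mul_cancel, koopman_one]
  conv_lhs => rw [h]
  exact (Lp.compMeasurePreservingₗᵢ ℝ (g • ·) (measurePreserving_smul g m) :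
    Lp ℝ 2 m →ₗᵢ[ℝ] Lp ℝ 2 m).inner_map_map _ _

lemma koopman_mono (g : Γ) {f f' : Lp ℝ 2 m} (h : f ≤ f') : koopman m g f ≤ koopman m g f' := by
  rw [← Lp.coeFn_le] at h ⊢
  filter_upwards [coeFn_koopman g f, coeFn_koopman g f',
    (measurePreserving_smul g m).quasiMeasurePreserving.ae h] with x h1 h2 h3
  rw [h1, h2]
  exact h3

lemma inner_koopman_eq_integral (g : Γ) (f f' : Lp ℝ 2 m) :
    ⟪koopman m g f, f'⟫_ℝ = ∫ x, f (g • x) * f' x ∂m := by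
  rw [L2.inner_def]
  refine integral_congr_ae ?_
  filter_upwards [coeFn_koopman g f] with x hx
  simp [hx, mul_comm]

variable (m) in
/-- The averaging operator on `L²` of the lazy version of the uniform measure on `S`. -/
def lazyAvg (S : Finset Γ) : Lp ℝ 2 m →L[ℝ] Lp ℝ 2 m :=
  (2 : ℝ)⁻¹ • ((S.card : ℝ)⁻¹ • ∑ s ∈ S, koopman m s) + (2 : ℝ)⁻¹ • 1

lemma lazyAvg_apply (S : Finset Γ) (f : Lp ℝ 2 m) :
    lazyAvg m S f = (2 : ℝ)⁻¹ • ((S.card : ℝ)⁻¹ • ∑ s ∈ S, koopman m s f) + (2 : ℝ)⁻¹ • f := by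
  simp [lazyAvg]

lemma inner_lazyAvg (S : Finset Γ) (hne : S.Nonempty) (f f' : Lp ℝ 2 m) :
    ⟪lazyAvg m S f, f'⟫_ℝ =
      expect (lazy (PMF.uniformOfFinset S hne)) fun g => ⟪koopman m g f, f'⟫_ℝ := by
  rw [expect_lazy (summable_expect_of_finite (by simp) _), expect_uniformOfFinset,
    lazyAvg_apply, koopman_one]
  simp [inner_add_left, real_inner_smul_left, sum_inner]

lemma inner_lazyAvg_symm {S : Finset Γ} (hS : ∀ s ∈ S, s⁻¹ ∈ S) (f f' : Lp ℝ 2 m) :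
    ⟪lazyAvg m S f, f'⟫_ℝ = ⟪f, lazyAvg m S f'⟫_ℝ := by
  rw [lazyAvg_apply, lazyAvg_apply]
  simp only [inner_add_left, inner_add_right, real_inner_smul_left, real_inner_smul_right,
    sum_inner, inner_sum]
  congr 3
  refine Finset.sum_nbij' (·⁻¹) (·⁻¹) hS hS (by simp) (by simp) fun s _ => ?_
  exact inner_koopman_left s f f'

/-- This is the purpose of laziness: an average of isometries has form at least `-‖f‖²`, and the
identity part compensates exactly. -/
lemma inner_lazyAvg_nonneg (S : Finset Γ) (hne : S.Nonempty) (f : Lp ℝ 2 m) :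
    0 ≤ ⟪lazyAvg m S f, f⟫_ℝ := by
  rw [lazyAvg_apply]
  simp only [inner_add_left, real_inner_smul_left, sum_inner, real_inner_self_eq_norm_sq]
  have h : ∀ s ∈ S, -(‖f‖ ^ 2) ≤ ⟪koopman m s f, f⟫_ℝ := by
    intro s _
    have := abs_real_inner_le_norm (koopman m s f) f
    rw [norm_koopman, ← sq] at this
    exact (abs_le.1 this).1
  have h1 := Finset.card_nsmul_le_sum S _ _ h
  have hc : (0 : ℝ) < S.card := by exact_mod_cast hne.card_pos
  rw [nsmul_eq_mul] at h1
  have h2 := mul_le_mul_of_nonneg_left h1 (inv_nonneg.2 hc.le)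
  rw [inv_mul_cancel_left₀ hc.ne'] at h2
  linarith

lemma lazyAvg_nonneg {S : Finset Γ} {f : Lp ℝ 2 m} (h : 0 ≤ f) : 0 ≤ lazyAvg m S f := by
  rw [lazyAvg_apply]
  have h1 : ∀ s ∈ S, 0 ≤ koopman m s f := fun s _ => by
    simpa using koopman_mono s h
  have h2 := Finset.sum_nonneg h1
  have h3 : (0 : ℝ) ≤ (S.card : ℝ)⁻¹ := by positivity
  have h4 : (0 : ℝ) ≤ (2 : ℝ)⁻¹ := by positivity
  exact add_nonneg (smul_nonneg_Lp h4 (smul_nonneg_Lp h3 h2)) (smul_nonneg_Lp h4 h)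

lemma lazyAvg_pow_nonneg {S : Finset Γ} {f : Lp ℝ 2 m} (h : 0 ≤ f) (n : ℕ) :
    0 ≤ (lazyAvg m S ^ n) f := by
  induction n with
  | zero => simpa using h
  | succ n ih =>
    rw [pow_succ', mul_apply_eq_comp]
    exact lazyAvg_nonneg ih

/-- The lazy step gives `s` weight at least `1 / (2 |S|)`, and the remaining terms are nonnegative.
-/
lemma koopman_le_lazyAvg {S : Finset Γ} {s : Γ} (hs : s ∈ S) {f : Lp ℝ 2 m} (h : 0 ≤ f) :
    koopman m s f ≤ (2 * S.card : ℝ) • lazyAvg m S f := by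
  have hc : (S.card : ℝ) ≠ 0 := by exact_mod_cast (Finset.card_pos.2 ⟨s, hs⟩).ne'
  have h1 : ∀ s ∈ S, 0 ≤ koopman m s f := fun s _ => by
    simpa using koopman_mono s h
  rw [lazyAvg_apply, smul_add, smul_smul, smul_smul, smul_smul]
  have e1 : (2 * S.card : ℝ) * (2⁻¹ * (S.card : ℝ)⁻¹) = 1 := by field_simp
  have e2 : (2 * S.card : ℝ) * 2⁻¹ = S.card := by field_simp
  rw [mul_assoc, e1, e2, one_smul]
  refine (Finset.single_le_sum h1 hs).trans (le_add_of_nonneg_right ?_)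
  exact smul_nonneg_Lp (Nat.cast_nonneg _) h

/-- The last increment is averaged first and moved onto `f'` by symmetry, so the induction must let
`f'` vary. -/
lemma expect_walk_inner {S : Finset Γ} (hne : S.Nonempty) (hS : ∀ s ∈ S, s⁻¹ ∈ S) (n : ℕ)
    (f f' : Lp ℝ 2 m) :
    expect (walk (lazy (PMF.uniformOfFinset S hne)) n) (fun g => ⟪koopman m g f, f'⟫_ℝ) =
      ⟪f, (lazyAvg m S ^ n) f'⟫_ℝ := by
  induction n generalizing f' with
  | zero => simp [walk, expect_pure, koopman_one]
  | succ n ih =>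
    rw [expect_walk_succ (by rw [lazy_support]; simp)]
    simp_rw [koopman_mul, ← inner_lazyAvg, inner_lazyAvg_symm hS]
    rw [ih, pow_succ, mul_apply_eq_comp]

end Koopman

/-! ### Norm bounds from decay on a cyclic nonnegative vector -/

section CyclicVector

open scoped InnerProductSpace

variable {Γ A : Type*} [Group Γ] [MulAction Γ A] [MeasurableSpace A] [MeasurableConstSMul Γ A]
  {m : Measure A} [SMulInvariantMeasure Γ A m]

/-- Translating by a generator costs only a constant factor and one step, so it does not affect the
exponential rate. Powers of the averaging operator preserve order, and the `L²` norm is monotone on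
nonnegative functions. -/
lemma norm_lazyAvg_pow_koopman_le {S : Finset Γ} {s : Γ} (hs : s ∈ S) {f : Lp ℝ 2 m}
    (hf : 0 ≤ f) (n : ℕ) :
    ‖(lazyAvg m S ^ n) (koopman m s f)‖ ≤ 2 * S.card * ‖(lazyAvg m S ^ (n + 1)) f‖ := by
  have h1 : 0 ≤ koopman m s f := by simpa using koopman_mono s hf
  have h2 := lazyAvg_pow_nonneg (S := S) (sub_nonneg.2 (koopman_le_lazyAvg hs hf)) n
  rw [map_sub, map_smul, ← mul_apply_eq_comp, ← pow_succ, sub_nonneg] at h2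
  have h3 := lazyAvg_pow_nonneg (S := S) h1 n
  have h4 : ‖(lazyAvg m S ^ n) (koopman m s f)‖ ≤
      ‖(2 * S.card : ℝ) • (lazyAvg m S ^ (n + 1)) f‖ := by
    refine norm_le_norm_of_abs_le_abs ?_
    rwa [abs_of_nonneg h3, abs_of_nonneg (h3.trans h2)]
  rwa [norm_smul, Real.norm_of_nonneg (by positivity)] at h4

/-- If the powers of the averaging operator decay on a nonnegative vector whose translates span a
dense subspace, then the operator norm is bounded by the rate of decay. -/
lemma norm_lazyAvg_le_of_cyclic {S : Finset Γ} (hS : ∀ s ∈ S, s⁻¹ ∈ S)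
    (hgen : Subgroup.closure (S : Set Γ) = ⊤) {δ : Lp ℝ 2 m} (hδ : 0 ≤ δ)
    (hdense : (Submodule.span ℝ (Set.range fun g : Γ => koopman m g δ)).topologicalClosure = ⊤)
    {ρ : ℝ} (hρ : 0 ≤ ρ) (hdecay : ∃ C, ∀ n, ‖(lazyAvg m S ^ n) δ‖ ≤ C * ρ ^ n)
    (f : Lp ℝ 2 m) : ‖lazyAvg m S f‖ ≤ ρ * ‖f‖ := by
  have step : ∀ (g s : Γ), s ∈ S →
      (0 ≤ koopman m g δ ∧ ∃ C, ∀ n, ‖(lazyAvg m S ^ n) (koopman m g δ)‖ ≤ C * ρ ^ n) →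
      (0 ≤ koopman m (g * s) δ ∧
        ∃ C, ∀ n, ‖(lazyAvg m S ^ n) (koopman m (g * s) δ)‖ ≤ C * ρ ^ n) := by
    rintro g s hs ⟨h0, C, hC⟩
    rw [koopman_mul]
    refine ⟨by simpa using koopman_mono s h0, 2 * S.card * C * ρ, fun n => ?_⟩
    refine (norm_lazyAvg_pow_koopman_le hs h0 n).trans ?_
    calc 2 * S.card * ‖(lazyAvg m S ^ (n + 1)) (koopman m g δ)‖
        ≤ 2 * S.card * (C * ρ ^ (n + 1)) := by gcongr; exact hC _
      _ = _ := by ring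
  have horbit : ∀ g : Γ,
      0 ≤ koopman m g δ ∧ ∃ C, ∀ n, ‖(lazyAvg m S ^ n) (koopman m g δ)‖ ≤ C * ρ ^ n := by
    intro g
    have hg : g ∈ Subgroup.closure (S : Set Γ) := by rw [hgen]; trivial
    induction hg using Subgroup.closure_induction_right with
    | one => rw [koopman_one]; exact ⟨hδ, hdecay⟩
    | mul_right g _ s hs ih => exact step g s hs ih
    | mul_inv_cancel g _ s hs ih => exact step g s⁻¹ (hS s hs) ih
  have hspan : ∀ x ∈ Submodule.span ℝ (Set.range fun g : Γ => koopman m g δ),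
      ∃ C, ∀ n, ‖(lazyAvg m S ^ n) x‖ ≤ C * ρ ^ n := by
    intro x hx
    induction hx using Submodule.span_induction with
    | mem x hx =>
      obtain ⟨g, rfl⟩ := hx
      exact (horbit g).2
    | zero => exact ⟨0, by simp⟩
    | add x y _ _ hx hy =>
      obtain ⟨C, hC⟩ := hx
      obtain ⟨D, hD⟩ := hy
      refine ⟨C + D, fun n => ?_⟩
      rw [map_add, add_mul]
      exact (norm_add_le _ _).trans (add_le_add (hC n) (hD n))
    | smul a x _ hx =>
      obtain ⟨C, hC⟩ := hx
      refine ⟨‖a‖ * C, fun n => ?_⟩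
      rw [map_smul, norm_smul, mul_assoc]
      exact mul_le_mul_of_nonneg_left (hC n) (norm_nonneg a)
  have hclosed : IsClosed {x : Lp ℝ 2 m | ‖lazyAvg m S x‖ ≤ ρ * ‖x‖} :=
    isClosed_le (by fun_prop) (by fun_prop)
  have hsub : ((Submodule.span ℝ (Set.range fun g : Γ => koopman m g δ) :
      Submodule ℝ (Lp ℝ 2 m)) : Set (Lp ℝ 2 m)) ⊆ {x | ‖lazyAvg m S x‖ ≤ ρ * ‖x‖} := by
    intro x hx
    obtain ⟨C, hC⟩ := hspan x hx
    -- The constants on the span are not uniform, but the resulting bound is, so it extends to the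
    -- closure.
    exact norm_apply_le_of_norm_pow_apply_le (inner_lazyAvg_symm hS) hρ hC
  refine closure_minimal hsub hclosed ?_
  rw [← Submodule.topologicalClosure_coe, hdense]
  trivial

end CyclicVector

/-! ### Point masses and return probabilities in `ℓ²` of a transitive action -/

section Count

open scoped InnerProductSpace

variable {Γ A : Type*} [Group Γ] [MulAction Γ A] [MeasurableSpace A]

section

variable [MeasurableSingletonClass A]

/-- The indicator function of a point as an element of `ℓ²`. -/
def pointMass (a : A) : Lp ℝ 2 (Measure.count : Measure A) :=
  indicatorConstLp 2 (measurableSet_singleton a) (by simp) 1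

lemma coeFn_pointMass (a x : A) : pointMass a x = Set.indicator {a} (fun _ => (1 : ℝ)) x :=
  Measure.ae_count_iff.1 indicatorConstLp_coeFn x

lemma pointMass_nonneg (a : A) : 0 ≤ pointMass a := by
  rw [← Lp.coeFn_nonneg]
  refine Filter.Eventually.of_forall fun x => ?_
  rw [coeFn_pointMass]
  exact Set.indicator_nonneg (fun _ _ => zero_le_one) _

lemma inner_pointMass (a : A) (f : Lp ℝ 2 (Measure.count : Measure A)) :
    ⟪pointMass a, f⟫_ℝ = f a := by
  rw [pointMass, L2.inner_indicatorConstLp_one, integral_singleton]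
  simp

end

variable [MeasurableConstSMul Γ A] [SMulInvariantMeasure Γ A (Measure.count : Measure A)]

lemma coeFn_koopman_count (g : Γ) (f : Lp ℝ 2 (Measure.count : Measure A)) (x : A) :
    koopman Measure.count g f x = f (g • x) :=
  Measure.ae_count_iff.1 (coeFn_koopman g f) x

variable [MeasurableSingletonClass A]

lemma koopman_pointMass (g : Γ) (a : A) :
    koopman Measure.count g (pointMass a) = pointMass (g⁻¹ • a) := by
  refine Lp.ext (Filter.Eventually.of_forall fun x => ?_)
  rw [coeFn_koopman_count, coeFn_pointMass, coeFn_pointMass]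
  by_cases h : g • x = a
  · rw [Set.indicator_of_mem (Set.mem_singleton_iff.2 h),
      Set.indicator_of_mem (Set.mem_singleton_iff.2 (eq_inv_smul_iff.2 h))]
  · rw [Set.indicator_of_notMem (mt Set.mem_singleton_iff.1 h),
      Set.indicator_of_notMem fun hx => h (eq_inv_smul_iff.1 (Set.mem_singleton_iff.1 hx))]

lemma topologicalClosure_span_pointMass [MulAction.IsPretransitive Γ A] (a : A) :
    (Submodule.span ℝ (Set.range fun g : Γ =>
      koopman Measure.count g (pointMass a))).topologicalClosure = ⊤ := by
  rw [Submodule.topologicalClosure_eq_top_iff, Submodule.eq_bot_iff]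
  intro f hf
  refine Lp.ext (Filter.Eventually.of_forall fun x => ?_)
  obtain ⟨g, rfl⟩ := MulAction.exists_smul_eq Γ x a
  have h := (Submodule.mem_orthogonal _ f).1 hf (pointMass x)
    (Submodule.subset_span ⟨g, by simp only [koopman_pointMass, inv_smul_smul]⟩)
  rw [inner_pointMass] at h
  rw [h, Measure.ae_count_iff.1 (Lp.coeFn_zero ℝ 2 _) x]
  rfl

/-- If the even return probabilities of the lazy random walk decay at rate `ρ`, then so does the
averaging operator on `ℓ²` of a transitive action. -/
lemma norm_lazyAvg_le_of_return_le [MulAction.IsPretransitive Γ A] {S : Finset Γ}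
    (hne : S.Nonempty) (hS : ∀ s ∈ S, s⁻¹ ∈ S) (hgen : Subgroup.closure (S : Set Γ) = ⊤) (a : A)
    {ρ : ℝ} (hρ : 0 ≤ ρ)
    (h : ∀ n, Even n → expect (walk (lazy (PMF.uniformOfFinset S hne)) n)
      (fun g => Set.indicator {a} (fun _ => (1 : ℝ)) (g • a)) ≤ ρ ^ n)
    (f : Lp ℝ 2 (Measure.count : Measure A)) :
    ‖lazyAvg Measure.count S f‖ ≤ ρ * ‖f‖ := by
  refine norm_lazyAvg_le_of_cyclic hS hgen (pointMass_nonneg a)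
    (topologicalClosure_span_pointMass a) hρ ⟨1, fun n => ?_⟩ f
  have hsymm : ∀ (k : ℕ) (x y : Lp ℝ 2 (Measure.count : Measure A)),
      ⟪(lazyAvg Measure.count S ^ k) x, y⟫_ℝ = ⟪x, (lazyAvg Measure.count S ^ k) y⟫_ℝ := by
    intro k
    induction k with
    | zero => simp
    | succ k ih =>
      intro x y
      rw [pow_succ', mul_apply_eq_comp, inner_lazyAvg_symm hS, ih, ← mul_apply_eq_comp,
        ← pow_succ, ← pow_succ']
  -- Only even times are needed: `‖M ^ n δ‖²` is the return probability at time `2n`.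
  have h1 := h (n + n) ⟨n, rfl⟩
  have h2 := expect_walk_inner (m := Measure.count) hne hS (n + n) (pointMass a) (pointMass a)
  rw [pow_add, mul_apply_eq_comp, ← hsymm n, real_inner_self_eq_norm_sq] at h2
  have h3 : ∀ g : Γ, ⟪koopman Measure.count g (pointMass a), pointMass a⟫_ℝ =
      Set.indicator {a} (fun _ => (1 : ℝ)) (g • a) := fun g => by
    rw [real_inner_comm, inner_pointMass, coeFn_koopman_count, coeFn_pointMass]
  simp_rw [h3] at h2
  rw [h2] at h1
  refine (sq_le_sq₀ (norm_nonneg _) (by positivity)).1 ?_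
  rw [one_mul, ← pow_mul, mul_two]
  exact h1

end Count

/-! ### Rayleigh quotients -/

section Rayleigh

variable {A : Type*} [MeasurableSpace A] {m : Measure A}

lemma integrable_comp_mul {T : A → A} (hT : MeasurePreserving T m m) {f : A → ℝ}
    (hf : MemLp f 2 m) : Integrable (fun x => f (T x) * f x) m :=
  (hf.comp_measurePreserving hT).integrable_mul hf

lemma integral_comp_sq {T : A → A} (hT : MeasurePreserving T m m) {f : A → ℝ}
    (hf : MemLp f 2 m) : ∫ x, f (T x) ^ 2 ∂m = ∫ x, f x ^ 2 ∂m := by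
  have h := integral_map (φ := T) (f := fun x => f x ^ 2) hT.measurable.aemeasurable
    (by rw [hT.map_eq]; exact hf.integrable_sq.aestronglyMeasurable)
  rw [hT.map_eq] at h
  exact h.symm

lemma integral_comp_eq {T : A → A} (hT : MeasurePreserving T m m) {f : A → ℝ}
    (hf : AEStronglyMeasurable f m) : ∫ x, f (T x) ∂m = ∫ x, f x ∂m := by
  have h := integral_map (φ := T) (f := f) hT.measurable.aemeasurable
    (by rwa [hT.map_eq])
  rw [hT.map_eq] at h
  exact h.symm

lemma integral_norm_comp_mul_le {T : A → A} (hT : MeasurePreserving T m m) {f : A → ℝ}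
    (hf : MemLp f 2 m) : ∫ x, ‖f (T x) * f x‖ ∂m ≤ ∫ x, f x ^ 2 ∂m := by
  have hfT : Integrable (fun x => f (T x) ^ 2) m := (hf.comp_measurePreserving hT).integrable_sq
  calc ∫ x, ‖f (T x) * f x‖ ∂m ≤ ∫ x, (2⁻¹ * f (T x) ^ 2 + 2⁻¹ * f x ^ 2) ∂m := by
        refine integral_mono (integrable_comp_mul hT hf).norm
          ((hfT.const_mul _).add (hf.integrable_sq.const_mul _)) fun x => ?_
        simp only [norm_mul, Real.norm_eq_abs]
        nlinarith [sq_nonneg (|f (T x)| - |f x|), sq_abs (f (T x)), sq_abs (f x)]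
    _ = ∫ x, f x ^ 2 ∂m := by
        rw [integral_add (hfT.const_mul _) (hf.integrable_sq.const_mul _), integral_const_mul,
          integral_const_mul]
        linarith [integral_comp_sq hT hf]

lemma abs_integral_comp_mul_le {T : A → A} (hT : MeasurePreserving T m m) {f : A → ℝ}
    (hf : MemLp f 2 m) : |∫ x, f (T x) * f x ∂m| ≤ ∫ x, f x ^ 2 ∂m :=
  (norm_integral_le_integral_norm _).trans (integral_norm_comp_mul_le hT hf)

lemma integral_comp_sub_sq {T : A → A} (hT : MeasurePreserving T m m) {f : A → ℝ}
    (hf : MemLp f 2 m) :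
    ∫ x, (f (T x) - f x) ^ 2 ∂m = 2 * ∫ x, f x ^ 2 ∂m - 2 * ∫ x, f (T x) * f x ∂m := by
  have hfT : Integrable (fun x => f (T x) ^ 2) m := (hf.comp_measurePreserving hT).integrable_sq
  have h1 : ∀ x, (f (T x) - f x) ^ 2 = f (T x) ^ 2 + f x ^ 2 - 2 * (f (T x) * f x) :=
    fun x => by ring
  simp_rw [h1]
  have hadd : Integrable (fun x => f (T x) ^ 2 + f x ^ 2) m := hfT.add hf.integrable_sq
  rw [integral_sub hadd ((integrable_comp_mul hT hf).const_mul _),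
    integral_const_mul, integral_add hfT hf.integrable_sq]
  linarith [integral_comp_sq hT hf]

variable {Γ : Type*} [Group Γ] [MulAction Γ A]

/-- The sum and integral are exchanged using the dominating series `p(g) ∫ f²`. Invariance is
required only on the support, so that the lemma applies to a component that only `K` preserves. -/
lemma integral_avg_mul [Countable Γ] {p : PMF Γ}
    (hp : ∀ g ∈ p.support, MeasurePreserving (fun x : A => g • x) m m) {f : A → ℝ}
    (hf : MemLp f 2 m) :
    ∫ x, avg p f x * f x ∂m = expect p fun g => ∫ x, f (g • x) * f x ∂m := by
  have hz : ∀ g, g ∉ p.support → p g = 0 := fun g hg => (PMF.apply_eq_zero_iff p g).2 hg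
  have hint : ∀ g, Integrable (fun x => (p g).toReal * (f (g • x) * f x)) m := by
    intro g
    by_cases hg : g ∈ p.support
    · exact (integrable_comp_mul (hp g hg) hf).const_mul _
    · simp [hz g hg]
  have hsum : Summable fun g => ∫ x, ‖(p g).toReal * (f (g • x) * f x)‖ ∂m := by
    refine Summable.of_nonneg_of_le (fun g => integral_nonneg fun x => norm_nonneg _) (fun g => ?_)
      ((hasSum_toReal p).summable.mul_right (∫ x, f x ^ 2 ∂m))
    simp_rw [norm_mul (p g).toReal, Real.norm_of_nonneg ENNReal.toReal_nonneg, integral_const_mul]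
    by_cases hg : g ∈ p.support
    · exact mul_le_mul_of_nonneg_left (integral_norm_comp_mul_le (hp g hg) hf)
        ENNReal.toReal_nonneg
    · simp [hz g hg]
  have h := hasSum_integral_of_summable_integral_norm hint hsum
  have h2 : ∀ x, ∑' g, (p g).toReal * (f (g • x) * f x) = avg p f x * f x := fun x => by
    rw [avg, ← tsum_mul_right]
    exact tsum_congr fun g => by ring
  simp_rw [h2, integral_const_mul] at h
  exact h.tsum_eq.symm

lemma summable_expect_integral {p : PMF Γ}
    (hp : ∀ g ∈ p.support, MeasurePreserving (fun x : A => g • x) m m) {f : A → ℝ}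
    (hf : MemLp f 2 m) : Summable fun g => (p g).toReal * ∫ x, f (g • x) * f x ∂m := by
  refine Summable.of_norm_bounded
    ((hasSum_toReal p).summable.mul_right (∫ x, f x ^ 2 ∂m)) fun g => ?_
  rw [norm_mul, Real.norm_of_nonneg ENNReal.toReal_nonneg]
  by_cases hg : g ∈ p.support
  · exact mul_le_mul_of_nonneg_left (abs_integral_comp_mul_le (hp g hg) hf) ENNReal.toReal_nonneg
  · simp [(PMF.apply_eq_zero_iff p g).2 hg]

lemma abs_integral_avg_mul_le [Countable Γ] {p : PMF Γ}
    (hp : ∀ g ∈ p.support, MeasurePreserving (fun x : A => g • x) m m) {f : A → ℝ}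
    (hf : MemLp f 2 m) : |∫ x, avg p f x * f x ∂m| ≤ ∫ x, f x ^ 2 ∂m := by
  rw [integral_avg_mul hp hf, expect]
  have h1 := (hasSum_toReal p).mul_right (∫ x, f x ^ 2 ∂m)
  rw [one_mul] at h1
  rw [← Real.norm_eq_abs]
  refine tsum_of_norm_bounded h1 fun g => ?_
  rw [norm_mul, Real.norm_of_nonneg ENNReal.toReal_nonneg]
  by_cases hg : g ∈ p.support
  · exact mul_le_mul_of_nonneg_left (abs_integral_comp_mul_le (hp g hg) hf) ENNReal.toReal_nonneg
  · simp [(PMF.apply_eq_zero_iff p g).2 hg]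

lemma integral_sq_pos {f : A → ℝ} (hf : MemLp f 2 m) (h0 : ¬ f =ᵐ[m] 0) :
    0 < ∫ x, f x ^ 2 ∂m := by
  refine lt_of_le_of_ne (integral_nonneg fun x => sq_nonneg _) fun h => h0 ?_
  have := (integral_eq_zero_iff_of_nonneg (fun x => sq_nonneg (f x)) hf.integrable_sq).1 h.symm
  filter_upwards [this] with x hx
  simpa using hx

/-- Boundedness is needed because the real `sSup` of an unbounded set is `0`. -/
lemma bddAbove_topSpectrum [Countable Γ] {p : PMF Γ}
    (hp : ∀ g ∈ p.support, MeasurePreserving (fun x : A => g • x) m m) :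
    BddAbove {r : ℝ | ∃ f : A → ℝ, MemLp f 2 m ∧ ∫ x, f x ∂m = 0 ∧ ¬ f =ᵐ[m] 0 ∧
      r = (∫ x, avg p f x * f x ∂m) / ∫ x, f x ^ 2 ∂m} := by
  refine ⟨1, ?_⟩
  rintro r ⟨f, hf, -, h0, rfl⟩
  rw [div_le_one (integral_sq_pos hf h0)]
  exact (abs_le.1 (abs_integral_avg_mul_le hp hf)).2

lemma integral_avg_mul_le_topSpectrum [Countable Γ] {p : PMF Γ}
    (hp : ∀ g ∈ p.support, MeasurePreserving (fun x : A => g • x) m m) {f : A → ℝ}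
    (hf : MemLp f 2 m) (hf0 : ∫ x, f x ∂m = 0) :
    ∫ x, avg p f x * f x ∂m ≤ topSpectrum m p * ∫ x, f x ^ 2 ∂m := by
  by_cases h0 : f =ᵐ[m] 0
  · have h1 : ∫ x, avg p f x * f x ∂m = 0 := by
      refine integral_eq_zero_of_ae ?_
      filter_upwards [h0] with x hx
      simp [hx]
    have h2 : ∫ x, f x ^ 2 ∂m = 0 := by
      refine integral_eq_zero_of_ae ?_
      filter_upwards [h0] with x hx
      simp [hx]
    rw [h1, h2, mul_zero]
  · rw [← div_le_iff₀ (integral_sq_pos hf h0)]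
    exact le_csSup (bddAbove_topSpectrum hp) ⟨f, hf, hf0, h0, rfl⟩

end Rayleigh

/-! ### The lazy random walk on a probability space -/

section Probability

open scoped InnerProductSpace

variable {Γ X : Type*} [Group Γ] [MulAction Γ X] [MeasurableSpace X] [MeasurableConstSMul Γ X]
  {μ : Measure X} [SMulInvariantMeasure Γ X μ]

lemma norm_sq_eq_integral (f : Lp ℝ 2 μ) : ‖f‖ ^ 2 = ∫ x, f x ^ 2 ∂μ := by
  rw [← real_inner_self_eq_norm_sq, L2.inner_def]
  simp [sq]

lemma integral_avg_lazy_eq_inner [Countable Γ] {S : Finset Γ} (hne : S.Nonempty) (f : Lp ℝ 2 μ) :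
    ∫ x, avg (lazy (PMF.uniformOfFinset S hne)) f x * f x ∂μ = ⟪lazyAvg μ S f, f⟫_ℝ := by
  rw [inner_lazyAvg S hne, integral_avg_mul (fun g _ => measurePreserving_smul g μ) (Lp.memLp f)]
  simp_rw [inner_koopman_eq_integral]

lemma topSpectrum_lazy_nonneg [Countable Γ] {S : Finset Γ} (hne : S.Nonempty) :
    0 ≤ topSpectrum μ (lazy (PMF.uniformOfFinset S hne)) := by
  refine Real.sSup_nonneg ?_
  rintro r ⟨f, hf, -, -, rfl⟩
  refine div_nonneg ?_ (integral_nonneg fun x => sq_nonneg _)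
  rw [integral_avg_mul (fun g _ => measurePreserving_smul g μ) hf]
  have h := inner_lazyAvg_nonneg S hne (hf.toLp f)
  rw [inner_lazyAvg S hne] at h
  refine h.trans_eq (tsum_congr fun g => ?_)
  simp only [inner_koopman_eq_integral]
  congr 1
  refine integral_congr_ae ?_
  filter_upwards [hf.coeFn_toLp,
    (measurePreserving_smul g μ).quasiMeasurePreserving.ae hf.coeFn_toLp] with x h1 h2
  rw [h1, h2]

variable [IsProbabilityMeasure μ]

variable (μ) in
/-- The square integrable functions with zero integral. -/
def meanZero : Submodule ℝ (Lp ℝ 2 μ) :=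
  (ℝ ∙ (indicatorConstLp 2 MeasurableSet.univ (measure_ne_top μ _) (1 : ℝ) : Lp ℝ 2 μ))ᗮ

lemma mem_meanZero {f : Lp ℝ 2 μ} : f ∈ meanZero μ ↔ ∫ x, f x ∂μ = 0 := by
  rw [meanZero, Submodule.mem_orthogonal_singleton_iff_inner_right,
    L2.inner_indicatorConstLp_one, setIntegral_univ]

lemma lazyAvg_mem_meanZero {S : Finset Γ} (hne : S.Nonempty) (hS : ∀ s ∈ S, s⁻¹ ∈ S)
    {f : Lp ℝ 2 μ} (hf : f ∈ meanZero μ) : lazyAvg μ S f ∈ meanZero μ := by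
  rw [meanZero, Submodule.mem_orthogonal_singleton_iff_inner_right] at hf ⊢
  rw [← inner_lazyAvg_symm hS, inner_lazyAvg S hne]
  have h : ∀ g : Γ, koopman μ g (indicatorConstLp 2 MeasurableSet.univ (measure_ne_top μ _)
      (1 : ℝ)) = indicatorConstLp 2 MeasurableSet.univ (measure_ne_top μ _) (1 : ℝ) :=
    fun g => Lp.indicatorConstLp_compMeasurePreserving MeasurableSet.univ (measure_ne_top μ _)
      (1 : ℝ) (measurePreserving_smul g μ)
  simp_rw [h, hf, expect_const]

/-- Since the lazy operator is positive, its form bound on mean-zero functions is a norm bound and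
can be iterated, for odd `n` too. -/
lemma expect_walk_integral_le [Countable Γ] {S : Finset Γ} (hne : S.Nonempty)
    (hS : ∀ s ∈ S, s⁻¹ ∈ S) {f : X → ℝ} (hf : MemLp f 2 μ) (hf0 : ∫ x, f x ∂μ = 0) (n : ℕ) :
    expect (walk (lazy (PMF.uniformOfFinset S hne)) n) (fun g => ∫ x, f (g • x) * f x ∂μ) ≤
      topSpectrum μ (lazy (PMF.uniformOfFinset S hne)) ^ n * ∫ x, f x ^ 2 ∂μ := by
  set ρ := topSpectrum μ (lazy (PMF.uniformOfFinset S hne))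
  have hρ : 0 ≤ ρ := topSpectrum_lazy_nonneg hne
  have hV : ∀ x ∈ meanZero μ, lazyAvg μ S x ∈ meanZero μ := fun x hx =>
    lazyAvg_mem_meanZero hne hS hx
  have hbound : ∀ x ∈ meanZero μ, ‖lazyAvg μ S x‖ ≤ ρ * ‖x‖ := fun x hx =>
    norm_apply_le_of_inner_le (inner_lazyAvg_symm hS) (inner_lazyAvg_nonneg S hne) hV hρ
      (fun y hy => by
        rw [← integral_avg_lazy_eq_inner hne, norm_sq_eq_integral]
        exact integral_avg_mul_le_topSpectrum (fun g _ => measurePreserving_smul g μ) (Lp.memLp y)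
          (mem_meanZero.1 hy)) hx
  set F : Lp ℝ 2 μ := hf.toLp f
  have hF : F ∈ meanZero μ := by
    rw [mem_meanZero, integral_congr_ae hf.coeFn_toLp, hf0]
  have h1 : ∀ g : Γ, ∫ x, f (g • x) * f x ∂μ = ⟪koopman μ g F, F⟫_ℝ := by
    intro g
    rw [inner_koopman_eq_integral]
    refine integral_congr_ae ?_
    filter_upwards [hf.coeFn_toLp,
      (measurePreserving_smul g μ).quasiMeasurePreserving.ae hf.coeFn_toLp] with x h1 h2
    rw [h1, h2]
  have h2 : ∫ x, f x ^ 2 ∂μ = ‖F‖ ^ 2 := by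
    rw [norm_sq_eq_integral]
    refine integral_congr_ae ?_
    filter_upwards [hf.coeFn_toLp] with x h1
    rw [h1]
  simp_rw [h1, h2]
  rw [expect_walk_inner hne hS]
  calc ⟪F, (lazyAvg μ S ^ n) F⟫_ℝ ≤ ‖F‖ * ‖(lazyAvg μ S ^ n) F‖ := real_inner_le_norm _ _
    _ ≤ ‖F‖ * (ρ ^ n * ‖F‖) := by
        gcongr
        exact norm_pow_apply_le hV hρ hbound hF n
    _ = ρ ^ n * ‖F‖ ^ 2 := by ring

/-- Quantitative nonconcentration: a nonnegative function that is almost invariant under the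
elements of `H` in the support of the random walk has a large integral. -/
lemma sub_mul_integral_sq_le [Countable Γ] {S : Finset Γ} (hne : S.Nonempty)
    (hS : ∀ s ∈ S, s⁻¹ ∈ S) (H : Subgroup Γ) (n : ℕ) {T : Finset Γ}
    (hT : ∀ g, g ∈ T ↔ g ∈ H ∧ g ∈ (walk (lazy (PMF.uniformOfFinset S hne)) n).support)
    {v : X → ℝ} (hv : MemLp v 2 μ) (hv0 : ∀ x, 0 ≤ v x) :
    (returnProb (lazy (PMF.uniformOfFinset S hne)) H n -
        topSpectrum μ (lazy (PMF.uniformOfFinset S hne)) ^ n) * ∫ x, v x ^ 2 ∂μ ≤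
      (∫ x, v x ∂μ) ^ 2 + ∑ h ∈ T, ∫ x, (v (h • x) - v x) ^ 2 ∂μ := by
  set p := lazy (PMF.uniformOfFinset S hne)
  set ρ := topSpectrum μ p
  have hρ : 0 ≤ ρ := topSpectrum_lazy_nonneg hne
  have hfin : (walk p n).support.Finite :=
    walk_support_finite (by rw [lazy_support]; simp) n
  have hvi : Integrable v μ := hv.integrable (by norm_num)
  set b := ∫ x, v x ∂μ with hb
  have hf : MemLp (fun x => v x - b) 2 μ := hv.sub (memLp_const b)
  have hf0 : ∫ x, (v x - b) ∂μ = 0 := by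
    rw [integral_sub hvi (integrable_const b)]
    simp [hb]
  have hcross : ∀ g : Γ, ∫ x, (v (g • x) - b) * (v x - b) ∂μ =
      ∫ x, v (g • x) * v x ∂μ - b ^ 2 := by
    intro g
    have hg := measurePreserving_smul g μ
    have hvg : Integrable (fun x => v (g • x)) μ :=
      (hv.comp_measurePreserving hg).integrable (by norm_num)
    have h1 : ∀ x, (v (g • x) - b) * (v x - b) =
        v (g • x) * v x - (b * v (g • x) + b * v x - b ^ 2) := fun x => by ring
    simp_rw [h1]
    have hadd : Integrable (fun x => b * v (g • x) + b * v x) μ :=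
      (hvg.const_mul b).add (hvi.const_mul b)
    have hsub : Integrable (fun x => b * v (g • x) + b * v x - b ^ 2) μ :=
      hadd.sub (integrable_const _)
    rw [integral_sub (integrable_comp_mul hg hv) hsub, integral_sub hadd (integrable_const _),
      integral_add (hvg.const_mul b) (hvi.const_mul b), integral_const_mul, integral_const_mul,
      integral_comp_eq hg hv.aestronglyMeasurable]
    simp only [integral_const, probReal_univ, one_smul]
    ring
  have hsq : ∫ x, (v x - b) ^ 2 ∂μ = ∫ x, v x ^ 2 ∂μ - b ^ 2 := by
    have := hcross 1
    simp only [one_smul] at this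
    simp_rw [sq (v _ - b), sq (v _)]
    exact this
  have hup := expect_walk_integral_le hne hS hf hf0 n
  simp_rw [hcross, hsq] at hup
  have hexp : expect (walk p n) (fun g => ∫ x, v (g • x) * v x ∂μ - b ^ 2) =
      expect (walk p n) (fun g => ∫ x, v (g • x) * v x ∂μ) - b ^ 2 := by
    rw [expect_eq_sum (T := hfin.toFinset) (by simp), expect_eq_sum (T := hfin.toFinset) (by simp)]
    have h1 := expect_eq_sum (p := walk p n) (T := hfin.toFinset) (by simp) (fun _ => b ^ 2)
    rw [expect_const] at h1
    conv_rhs => rw [h1]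
    rw [← Finset.sum_sub_distrib]
    exact Finset.sum_congr rfl fun g _ => by ring
  rw [hexp] at hup
  -- Nonnegativity of `v` allows all group elements outside `H` to be discarded.
  have hlow : ∑ h ∈ T, (walk p n h).toReal * ∫ x, v (h • x) * v x ∂μ ≤
      expect (walk p n) (fun g => ∫ x, v (g • x) * v x ∂μ) := by
    rw [expect_eq_sum (T := hfin.toFinset) (by simp)]
    refine Finset.sum_le_sum_of_subset_of_nonneg (fun g hg => ?_) fun g _ _ => ?_
    · simpa using ((hT g).1 hg).2
    · exact mul_nonneg ENNReal.toReal_nonneg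
        (integral_nonneg fun x => mul_nonneg (hv0 _) (hv0 _))
  -- This is `⟨h v, v⟩ = ‖v‖² - ‖h v - v‖² / 2`, with the weight and the factor `1 / 2` of the error
  -- both bounded by `1`.
  have hterm : ∀ h ∈ T, (walk p n h).toReal * ∫ x, v x ^ 2 ∂μ -
      ∫ x, (v (h • x) - v x) ^ 2 ∂μ ≤ (walk p n h).toReal * ∫ x, v (h • x) * v x ∂μ := by
    intro h _
    have h1 := integral_comp_sub_sq (measurePreserving_smul h μ) hv
    have h2 : 0 ≤ ∫ x, (v (h • x) - v x) ^ 2 ∂μ := integral_nonneg fun x => sq_nonneg _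
    have h3 : (walk p n h).toReal ≤ 1 := by
      rw [← ENNReal.toReal_one]
      exact ENNReal.toReal_mono ENNReal.one_ne_top (PMF.coe_le_one _ _)
    nlinarith [ENNReal.toReal_nonneg (a := walk p n h)]
  have hsum := Finset.sum_le_sum hterm
  rw [Finset.sum_sub_distrib, ← Finset.sum_mul, ← returnProb_eq_sum H hT] at hsum
  -- The upper bound is `b² + ρ ^ n (‖v‖² - b²)`; the term `-ρ ^ n b²` is dropped.
  nlinarith [mul_nonneg (pow_nonneg hρ n) (sq_nonneg b)]

end Probability

/-! ### Asymptotic independence and the moment inequality for almost invariant sequences -/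

section AlmostInvariant

open scoped InnerProductSpace Topology
open Filter

variable {G X : Type*} [Group G] [MulAction G X] [MeasurableSpace X] [MeasurableConstSMul G X]
  {P : Measure X} [SMulInvariantMeasure G X P]

variable (G P) in
/-- Every measurable set that is invariant modulo null sets is null or conull. -/
def ErgodicModNull : Prop :=
  ∀ Z : Set X, MeasurableSet Z → (∀ g : G, (fun x : X => g • x) ⁻¹' Z =ᵐ[P] Z) →
    P Z = 0 ∨ P Zᶜ = 0

variable (G P) in
/-- A sequence of functions that is asymptotically invariant in `L²`. -/
def AlmostInvariant (u : ℕ → X → ℝ) : Prop :=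
  ∀ g : G, Tendsto (fun k => ∫ x, (u k (g • x) - u k x) ^ 2 ∂P) atTop (𝓝 0)

/-- Every preimage under `f` of a measurable set is invariant modulo null sets, hence null or
conull. -/
lemma ae_eq_const_of_koopman_eq (herg : ErgodicModNull G P) {f : Lp ℝ 2 P}
    (hf : ∀ g : G, koopman P g f = f) : ∃ c, f =ᵐ[P] Function.const X c := by
  refine exists_eventuallyEq_const_of_forall_separating MeasurableSet fun U hU => ?_
  have hfm : Measurable f := (Lp.stronglyMeasurable f).measurable
  have hinv : ∀ g : G, (fun x : X => g • x) ⁻¹' (f ⁻¹' U) =ᵐ[P] f ⁻¹' U := by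
    intro g
    have h1 := coeFn_koopman g f
    rw [hf g] at h1
    refine (h1.mono fun x hx => ?_).set_eq
    simp only [Set.mem_preimage, hx]
  rcases herg (f ⁻¹' U) (hfm hU) hinv with h | h
  · right
    exact measure_eq_zero_iff_ae_notMem.1 h
  · left
    filter_upwards [measure_eq_zero_iff_ae_notMem.1 h] with x hx
    simpa using hx

lemma tendsto_inner_of_bounded {E : Type*} [NormedAddCommGroup E] [InnerProductSpace ℝ E]
    {U : ℕ → E} {C : ℝ} (hC : ∀ k, ‖U k‖ ≤ C) {D : Set E}
    (hD : ∀ y ∈ D, Tendsto (fun k => ⟪U k, y⟫_ℝ) atTop (𝓝 0)) {w : E} (hw : w ∈ closure D) :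
    Tendsto (fun k => ⟪U k, w⟫_ℝ) atTop (𝓝 0) := by
  have hC0 : 0 ≤ C := (norm_nonneg _).trans (hC 0)
  rw [Metric.tendsto_nhds]
  intro ε hε
  obtain ⟨y, hy, hwy⟩ := Metric.mem_closure_iff.1 hw (ε / (2 * (C + 1))) (by positivity)
  filter_upwards [Metric.tendsto_nhds.1 (hD y hy) (ε / 2) (by positivity)] with k hk
  rw [Real.dist_eq, sub_zero] at hk ⊢
  have h1 : ⟪U k, w⟫_ℝ = ⟪U k, y⟫_ℝ + ⟪U k, w - y⟫_ℝ := by rw [inner_sub_right]; ring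
  have h2 : |⟪U k, w - y⟫_ℝ| ≤ ε / 2 := by
    refine (abs_real_inner_le_norm _ _).trans ?_
    rw [dist_eq_norm] at hwy
    calc ‖U k‖ * ‖w - y‖ ≤ (C + 1) * (ε / (2 * (C + 1))) := by
          gcongr
          linarith [hC k]
      _ = ε / 2 := by field_simp
  rw [h1]
  exact (abs_add_le _ _).trans_lt (by linarith)

lemma inner_toLp {f g : X → ℝ} (hf : MemLp f 2 P) (hg : MemLp g 2 P) :
    ⟪hf.toLp f, hg.toLp g⟫_ℝ = ∫ x, f x * g x ∂P := by
  rw [L2.inner_def]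
  refine integral_congr_ae ?_
  filter_upwards [hf.coeFn_toLp, hg.coeFn_toLp] with x h1 h2
  simp [h1, h2, mul_comm]

lemma norm_toLp_sq {f : X → ℝ} (hf : MemLp f 2 P) : ‖hf.toLp f‖ ^ 2 = ∫ x, f x ^ 2 ∂P := by
  rw [← real_inner_self_eq_norm_sq, inner_toLp]
  simp_rw [sq]

lemma sq_integral_mul_le {f g : X → ℝ} (hf : MemLp f 2 P) (hg : MemLp g 2 P) :
    (∫ x, f x * g x ∂P) ^ 2 ≤ (∫ x, f x ^ 2 ∂P) * ∫ x, g x ^ 2 ∂P := by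
  rw [← inner_toLp hf hg, ← norm_toLp_sq hf, ← norm_toLp_sq hg, ← mul_pow, sq_le_sq,
    abs_of_nonneg (mul_nonneg (norm_nonneg _) (norm_nonneg _))]
  exact abs_real_inner_le_norm _ _

/-- Under an ergodic action an asymptotically invariant sequence converges weakly to zero on
functions with zero integral. -/
lemma AlmostInvariant.tendsto_integral_mul [IsFiniteMeasure P] (herg : ErgodicModNull G P)
    {u : ℕ → X → ℝ}
    (hu : AlmostInvariant G P u) (hmem : ∀ k, MemLp (u k) 2 P) {C : ℝ}
    (hC : ∀ k, ∫ x, u k x ^ 2 ∂P ≤ C) {w : X → ℝ} (hw : MemLp w 2 P) (hw0 : ∫ x, w x ∂P = 0) :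
    Tendsto (fun k => ∫ x, u k x * w x ∂P) atTop (𝓝 0) := by
  set U : ℕ → Lp ℝ 2 P := fun k => (hmem k).toLp (u k)
  -- On the span of the coboundaries `g x - x` the claim follows by moving `g` onto the almost
  -- invariant sequence.
  set D : Submodule ℝ (Lp ℝ 2 P) :=
    Submodule.span ℝ {z | ∃ (g : G) (x : Lp ℝ 2 P), z = koopman P g x - x}
  have hU : ∀ k, ‖U k‖ ≤ √C := fun k => by
    refine Real.le_sqrt_of_sq_le ?_
    rw [norm_toLp_sq]
    exact hC k
  have hsmall : ∀ g : G, Tendsto (fun k => ‖koopman P g (U k) - U k‖) atTop (𝓝 0) := by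
    intro g
    have h1 : ∀ k, ‖koopman P g (U k) - U k‖ = √(∫ x, (u k (g • x) - u k x) ^ 2 ∂P) := by
      intro k
      have h2 : koopman P g (U k) - U k = (((hmem k).comp_measurePreserving
          (measurePreserving_smul g P)).sub (hmem k)).toLp _ := by
        rw [MemLp.toLp_sub ((hmem k).comp_measurePreserving (measurePreserving_smul g P)) (hmem k)]
        rfl
      rw [h2, ← Real.sqrt_sq (norm_nonneg _), norm_toLp_sq]
      rfl
    simp_rw [h1]
    simpa using (hu g).sqrt
  have hD : ∀ y ∈ D, Tendsto (fun k => ⟪U k, y⟫_ℝ) atTop (𝓝 0) := by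
    intro y hy
    induction hy using Submodule.span_induction with
    | mem y hy =>
      obtain ⟨g, x, rfl⟩ := hy
      have h1 : ∀ k, ⟪U k, koopman P g x - x⟫_ℝ = ⟪koopman P g⁻¹ (U k) - U k, x⟫_ℝ := by
        intro k
        rw [inner_sub_right, inner_sub_left, inner_koopman_left, inv_inv]
      simp_rw [h1]
      refine squeeze_zero_norm (fun k => norm_inner_le_norm _ _) ?_
      simpa using (hsmall g⁻¹).mul_const ‖x‖
    | zero => simp
    | add x y _ _ hx hy => simpa [inner_add_right] using hx.add hy
    | smul a x _ hx => simpa [real_inner_smul_right] using hx.const_mul a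
  -- A vector orthogonal to all coboundaries is invariant, hence constant by ergodicity, hence
  -- orthogonal to `w`. So `w` lies in the double orthogonal complement of `D`, which is its
  -- closure.
  have hwD : hw.toLp w ∈ closure (D : Set (Lp ℝ 2 P)) := by
    rw [← Submodule.topologicalClosure_coe, ← Submodule.orthogonal_orthogonal_eq_closure]
    refine (Submodule.mem_orthogonal _ _).2 fun y hy => ?_
    have hinv : ∀ g : G, koopman P g y = y := by
      intro g
      have h1 := (Submodule.mem_orthogonal _ _).1 hy (koopman P g y - y)
        (Submodule.subset_span ⟨g, y, rfl⟩)
      rw [inner_sub_left, real_inner_self_eq_norm_sq] at h1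
      have h2 : ‖koopman P g y - y‖ ^ 2 = 0 := by
        rw [norm_sub_sq_real, norm_koopman]
        linarith
      exact sub_eq_zero.1 (norm_eq_zero.1 (pow_eq_zero_iff two_ne_zero |>.1 h2))
    obtain ⟨c, hc⟩ := ae_eq_const_of_koopman_eq herg hinv
    rw [L2.inner_def]
    have h3 : ∫ x, ⟪y x, hw.toLp w x⟫_ℝ ∂P = ∫ x, c * w x ∂P := by
      refine integral_congr_ae ?_
      filter_upwards [hc, hw.coeFn_toLp] with x h1 h2
      simp [h1, h2, mul_comm]
    rw [h3, integral_const_mul, hw0, mul_zero]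
  refine (tendsto_inner_of_bounded hU hD hwD).congr fun k => ?_
  exact inner_toLp (hmem k) hw

/-- Subtracting from `w` its mean reduces to the mean-zero case. The result is asymptotic
independence of `u k` from each fixed `w`, which makes moments of products multiply. -/
lemma AlmostInvariant.tendsto_integral_mul_const [IsProbabilityMeasure P]
    (herg : ErgodicModNull G P) {u : ℕ → X → ℝ}
    (hu : AlmostInvariant G P u) (hmem : ∀ k, MemLp (u k) 2 P) {C : ℝ}
    (hC : ∀ k, ∫ x, u k x ^ 2 ∂P ≤ C) {w : X → ℝ} (hw : MemLp w 2 P) {α : ℝ}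
    (hα : Tendsto (fun k => ∫ x, u k x ∂P) atTop (𝓝 α)) :
    Tendsto (fun k => ∫ x, u k x * w x ∂P) atTop (𝓝 (α * ∫ x, w x ∂P)) := by
  set b := ∫ x, w x ∂P with hb
  have hwi : Integrable w P := hw.integrable (by norm_num)
  have hw' : MemLp (fun x => w x - b) 2 P := hw.sub (memLp_const b)
  have h0 : ∫ x, (w x - b) ∂P = 0 := by
    rw [integral_sub hwi (integrable_const b)]
    simp [hb]
  have h1 := (hu.tendsto_integral_mul herg hmem hC hw' h0).add (hα.mul_const b)
  rw [zero_add] at h1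
  refine h1.congr fun k => ?_
  have hui : Integrable (u k) P := (hmem k).integrable (by norm_num)
  have hmul : Integrable (fun x => u k x * (w x - b)) P := (hmem k).integrable_mul hw'
  rw [← integral_mul_const, ← integral_add hmul (hui.mul_const b)]
  exact integral_congr_ae (Eventually.of_forall fun x => by ring)

lemma memLp_of_mem_unitInterval [IsFiniteMeasure P] {u : X → ℝ} (hm : AEStronglyMeasurable u P)
    (h : ∀ x, u x ∈ Set.Icc (0 : ℝ) 1) : MemLp u 2 P :=
  MemLp.of_bound hm 1 (Eventually.of_forall fun x => by
    rw [Real.norm_of_nonneg (h x).1]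
    exact (h x).2)

/-- Products of asymptotically invariant functions realize the powers of the limiting first and
second moments. -/
lemma AlmostInvariant.exists_pow [IsProbabilityMeasure P] (herg : ErgodicModNull G P)
    {u : ℕ → X → ℝ} (hu : AlmostInvariant G P u) (hm : ∀ k, AEStronglyMeasurable (u k) P)
    (hI : ∀ k x, u k x ∈ Set.Icc (0 : ℝ) 1) {α β : ℝ}
    (hα : Tendsto (fun k => ∫ x, u k x ∂P) atTop (𝓝 α))
    (hβ : Tendsto (fun k => ∫ x, u k x ^ 2 ∂P) atTop (𝓝 β))
    {ι : Type*} [Fintype ι] (t : ι → G) (j : ℕ) {ε : ℝ} (hε : 0 < ε) :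
    ∃ w : X → ℝ, AEStronglyMeasurable w P ∧ (∀ x, w x ∈ Set.Icc (0 : ℝ) 1) ∧
      ∑ i, ∫ x, (w (t i • x) - w x) ^ 2 ∂P < ε ∧ |∫ x, w x ∂P - α ^ j| < ε ∧
      |∫ x, w x ^ 2 ∂P - β ^ j| < ε := by
  have hmem : ∀ k, MemLp (u k) 2 P := fun k => memLp_of_mem_unitInterval (hm k) (hI k)
  have hI2 : ∀ k x, u k x ^ 2 ∈ Set.Icc (0 : ℝ) 1 := fun k x =>
    ⟨sq_nonneg _, pow_le_one₀ (hI k x).1 (hI k x).2⟩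
  have hmem2 : ∀ k, MemLp (fun x => u k x ^ 2) 2 P := fun k =>
    memLp_of_mem_unitInterval ((hm k).pow 2) (hI2 k)
  have hle : ∀ {f : X → ℝ}, (∀ x, f x ∈ Set.Icc (0 : ℝ) 1) → ∫ x, f x ∂P ∈ Set.Icc (0 : ℝ) 1 := by
    intro f hf
    refine ⟨integral_nonneg fun x => (hf x).1, ?_⟩
    have h := integral_mono_of_nonneg (μ := P) (f := f) (g := fun _ => (1 : ℝ))
      (Eventually.of_forall fun x => (hf x).1)
      (integrable_const _) (Eventually.of_forall fun x => (hf x).2)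
    simpa using h
  have hαI : α ∈ Set.Icc (0 : ℝ) 1 := isClosed_Icc.mem_of_tendsto hα
    (Eventually.of_forall fun k => hle (hI k))
  have hβI : β ∈ Set.Icc (0 : ℝ) 1 := isClosed_Icc.mem_of_tendsto hβ
    (Eventually.of_forall fun k => hle (hI2 k))
  -- Squaring is `2`-Lipschitz on `[0, 1]`, whence the factor `4`.
  have hu2 : AlmostInvariant G P fun k x => u k x ^ 2 := by
    intro g
    have h4 := (hu g).const_mul 4
    rw [mul_zero] at h4
    refine squeeze_zero (fun k => integral_nonneg fun x => sq_nonneg _) (fun k => ?_) h4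
    rw [← integral_const_mul]
    have hg := measurePreserving_smul g P
    refine integral_mono (((hmem2 k).comp_measurePreserving hg).sub (hmem2 k)).integrable_sq
      ((((hmem k).comp_measurePreserving hg).sub (hmem k)).integrable_sq.const_mul 4) fun x => ?_
    have h1 := hI k (g • x)
    have h2 := hI k x
    have e : (u k (g • x) ^ 2 - u k x ^ 2) ^ 2 =
        (u k (g • x) + u k x) ^ 2 * (u k (g • x) - u k x) ^ 2 := by ring
    show (u k (g • x) ^ 2 - u k x ^ 2) ^ 2 ≤ 4 * (u k (g • x) - u k x) ^ 2
    rw [e]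
    refine mul_le_mul_of_nonneg_right ?_ (sq_nonneg _)
    nlinarith [h1.1, h1.2, h2.1, h2.2]
  induction j generalizing ε with
  | zero => exact ⟨fun _ => 1, aestronglyMeasurable_const, by simp, by simpa, by simpa, by simpa⟩
  | succ j ih =>
    -- The next factor is `u k` with `k` large depending on this fixed `w`. The displacement of the
    -- product is at most twice the sum of the two displacements, each below `ε / 4`.
    obtain ⟨w, hwm, hwI, hw1, hw2, hw3⟩ := ih (ε := ε / 4) (by positivity)
    have hwmem : MemLp w 2 P := memLp_of_mem_unitInterval hwm hwI
    have hwI2 : ∀ x, w x ^ 2 ∈ Set.Icc (0 : ℝ) 1 := fun x =>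
      ⟨sq_nonneg _, pow_le_one₀ (hwI x).1 (hwI x).2⟩
    have hwmem2 : MemLp (fun x => w x ^ 2) 2 P := memLp_of_mem_unitInterval (hwm.pow 2) hwI2
    have t1 : Tendsto (fun k => ∫ x, u k x * w x ∂P) atTop (𝓝 (α * ∫ x, w x ∂P)) :=
      hu.tendsto_integral_mul_const herg hmem (fun k => (hle (hI2 k)).2) hwmem hα
    have t2 : Tendsto (fun k => ∫ x, u k x ^ 2 * w x ^ 2 ∂P) atTop
        (𝓝 (β * ∫ x, w x ^ 2 ∂P)) :=
      hu2.tendsto_integral_mul_const herg hmem2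
        (fun k => (hle fun x => ⟨sq_nonneg _, pow_le_one₀ (hI2 k x).1 (hI2 k x).2⟩).2) hwmem2 hβ
    have t3 : Tendsto (fun k => ∑ i, ∫ x, (u k (t i • x) - u k x) ^ 2 ∂P) atTop (𝓝 0) := by
      simpa using tendsto_finsetSum Finset.univ fun i _ => hu (t i)
    have b1 : |α * ∫ x, w x ∂P - α ^ (j + 1)| < ε := by
      rw [pow_succ', ← mul_sub, abs_mul, abs_of_nonneg hαI.1]
      nlinarith [abs_nonneg (∫ x, w x ∂P - α ^ j), hαI.1, hαI.2]
    have b2 : |β * ∫ x, w x ^ 2 ∂P - β ^ (j + 1)| < ε := by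
      rw [pow_succ', ← mul_sub, abs_mul, abs_of_nonneg hβI.1]
      nlinarith [abs_nonneg (∫ x, w x ^ 2 ∂P - β ^ j), hβI.1, hβI.2]
    obtain ⟨k, k1, k2, k3⟩ := (((t1.sub_const (α ^ (j + 1))).abs.eventually_lt_const b1).and
      (((t2.sub_const (β ^ (j + 1))).abs.eventually_lt_const b2).and
        (t3.eventually_lt_const (show (0 : ℝ) < ε / 4 by positivity)))).exists
    refine ⟨fun x => u k x * w x, (hm k).mul hwm, fun x => ⟨mul_nonneg (hI k x).1 (hwI x).1,
      mul_le_one₀ (hI k x).2 (hwI x).1 (hwI x).2⟩, ?_, k1, ?_⟩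
    · have hi : ∀ i, ∫ x, (u k (t i • x) * w (t i • x) - u k x * w x) ^ 2 ∂P ≤
          2 * ∫ x, (u k (t i • x) - u k x) ^ 2 ∂P + 2 * ∫ x, (w (t i • x) - w x) ^ 2 ∂P := by
        intro i
        have hg := measurePreserving_smul (t i) P
        have i1 : Integrable (fun x => (u k (t i • x) - u k x) ^ 2) P :=
          (((hmem k).comp_measurePreserving hg).sub (hmem k)).integrable_sq
        have i2 : Integrable (fun x => (w (t i • x) - w x) ^ 2) P :=
          ((hwmem.comp_measurePreserving hg).sub hwmem).integrable_sq
        rw [← integral_const_mul, ← integral_const_mul,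
          ← integral_add (i1.const_mul 2) (i2.const_mul 2)]
        refine integral_mono_of_nonneg (Eventually.of_forall fun x => sq_nonneg _)
          ((i1.const_mul 2).add (i2.const_mul 2)) (Eventually.of_forall fun x => ?_)
        have h1 := hI k x
        have h2 := hwI (t i • x)
        have e : u k (t i • x) * w (t i • x) - u k x * w x =
          (u k (t i • x) - u k x) * w (t i • x) + u k x * (w (t i • x) - w x) := by ring
        show (u k (t i • x) * w (t i • x) - u k x * w x) ^ 2 ≤
          2 * (u k (t i • x) - u k x) ^ 2 + 2 * (w (t i • x) - w x) ^ 2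
        rw [e]
        have s1 : ((u k (t i • x) - u k x) * w (t i • x)) ^ 2 ≤ (u k (t i • x) - u k x) ^ 2 := by
          rw [mul_pow]
          exact mul_le_of_le_one_right (sq_nonneg _) (pow_le_one₀ h2.1 h2.2)
        have s2 : (u k x * (w (t i • x) - w x)) ^ 2 ≤ (w (t i • x) - w x) ^ 2 := by
          rw [mul_pow]
          exact mul_le_of_le_one_left (sq_nonneg _) (pow_le_one₀ h1.1 h1.2)
        refine add_sq_le.trans ?_
        linarith
      have := Finset.sum_le_sum fun i (_ : i ∈ Finset.univ) => hi i
      rw [Finset.sum_add_distrib, ← Finset.mul_sum, ← Finset.mul_sum] at this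
      linarith
    · simpa only [mul_pow] using k2

/-- If nonnegative functions that are almost invariant under finitely many elements do not
concentrate, then asymptotically invariant functions are asymptotically constant. -/
lemma AlmostInvariant.second_moment_le [IsProbabilityMeasure P] (herg : ErgodicModNull G P)
    {ι : Type*} [Fintype ι] {t : ι → G} {c : ℝ} (hc : 0 < c)
    (hK : ∀ v : X → ℝ, MemLp v 2 P → (∀ x, 0 ≤ v x) →
      c * ∫ x, v x ^ 2 ∂P ≤ (∫ x, v x ∂P) ^ 2 + ∑ i, ∫ x, (v (t i • x) - v x) ^ 2 ∂P)
    {u : ℕ → X → ℝ} (hu : AlmostInvariant G P u) (hm : ∀ k, AEStronglyMeasurable (u k) P)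
    (hI : ∀ k x, u k x ∈ Set.Icc (0 : ℝ) 1) {α β : ℝ}
    (hα : Tendsto (fun k => ∫ x, u k x ∂P) atTop (𝓝 α))
    (hβ : Tendsto (fun k => ∫ x, u k x ^ 2 ∂P) atTop (𝓝 β)) : β ≤ α ^ 2 := by
  -- The nonconcentration inequality is applied to the `j`-fold products, with errors tending to
  -- zero. As `c` does not depend on `j`, large powers make it irrelevant.
  have key : ∀ j : ℕ, c * β ^ j ≤ (α ^ 2) ^ j := by
    intro j
    choose! w hwm hwI hw1 hw2 hw3 using fun ε (hε : (0 : ℝ) < ε) =>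
      hu.exists_pow herg hm hI hα hβ t j hε
    have hid : Tendsto (fun ε : ℝ => ε) (𝓝[>] 0) (𝓝 0) := nhdsWithin_le_nhds
    have hpos : ∀ᶠ ε : ℝ in 𝓝[>] 0, 0 < ε := self_mem_nhdsWithin
    have t1 : Tendsto (fun ε => ∫ x, w ε x ∂P) (𝓝[>] 0) (𝓝 (α ^ j)) := by
      rw [tendsto_iff_dist_tendsto_zero]
      exact squeeze_zero' (Eventually.of_forall fun _ => dist_nonneg)
        (hpos.mono fun ε h => (hw2 ε h).le) hid
    have t2 : Tendsto (fun ε => ∫ x, w ε x ^ 2 ∂P) (𝓝[>] 0) (𝓝 (β ^ j)) := by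
      rw [tendsto_iff_dist_tendsto_zero]
      exact squeeze_zero' (Eventually.of_forall fun _ => dist_nonneg)
        (hpos.mono fun ε h => (hw3 ε h).le) hid
    have h := le_of_tendsto_of_tendsto (t2.const_mul c) ((t1.pow 2).add hid)
      (hpos.mono fun ε h => (hK (w ε) (memLp_of_mem_unitInterval (hwm ε h) (hwI ε h))
        fun x => (hwI ε h x).1).trans (add_le_add_right (hw1 ε h).le _))
    rwa [add_zero, ← pow_mul, mul_comm j, pow_mul] at h
  by_contra! hlt
  have hβ0 : 0 < β := (sq_nonneg α).trans_lt hlt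
  have hle : ∀ j : ℕ, c ≤ (α ^ 2 / β) ^ j := fun j => by
    rw [div_pow, le_div_iff₀ (pow_pos hβ0 j)]
    exact key j
  have hlim := tendsto_pow_atTop_nhds_zero_of_lt_one
    (div_nonneg (sq_nonneg α) hβ0.le) ((div_lt_one hβ0).2 hlt)
  have := ge_of_tendsto' hlim hle
  linarith

end AlmostInvariant

/-! ### Truncation, and excluding almost invariant mean-zero unit vectors -/

section Gap

open scoped Topology
open Filter

variable {G X : Type*} [Group G] [MulAction G X] [MeasurableSpace X] [MeasurableConstSMul G X]
  {P : Measure X} [SMulInvariantMeasure G X P]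

/-- The truncation of a real number to the interval `[-t, t]`. -/
def clip (t a : ℝ) : ℝ := max (min a t) (-t)

/-- The part of the absolute value of a real number that exceeds `t`. -/
def excess (t a : ℝ) : ℝ := max (|a| - t) 0

lemma abs_clip_sub_clip_le (t a b : ℝ) : |clip t a - clip t b| ≤ |a - b| :=
  (abs_max_sub_max_le_abs _ _ _).trans <| by
    simpa using abs_min_sub_min_le_max a t b t

lemma abs_excess_sub_excess_le (t a b : ℝ) : |excess t a - excess t b| ≤ |a - b| := by
  refine (abs_max_sub_max_le_abs _ _ _).trans ?_
  rw [sub_sub_sub_cancel_right]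
  exact abs_abs_sub_abs_le_abs_sub a b

lemma excess_nonneg (t a : ℝ) : 0 ≤ excess t a := le_max_right _ _

lemma abs_clip_le {t : ℝ} (ht : 0 ≤ t) (a : ℝ) : |clip t a| ≤ t := by
  rw [abs_le, clip]
  exact ⟨le_max_right _ _, max_le (min_le_right _ _) (by linarith)⟩

lemma abs_sub_clip {t : ℝ} (ht : 0 ≤ t) (a : ℝ) : |a - clip t a| = excess t a := by
  rw [clip, excess]
  rcases le_total a t with h1 | h1
  · rw [min_eq_left h1]
    rcases le_total (-t) a with h2 | h2
    · rw [max_eq_left h2, sub_self, abs_zero, max_eq_right]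
      linarith [abs_le.2 ⟨h2, h1⟩]
    · rw [max_eq_right h2, abs_of_nonpos (by linarith), abs_of_nonpos (by linarith),
        max_eq_left (by linarith)]
      ring
  · rw [min_eq_right h1, max_eq_left (by linarith), abs_of_nonneg (by linarith),
      abs_of_nonneg (by linarith), max_eq_left (by linarith)]

lemma mul_excess_le {t : ℝ} (a : ℝ) : t * excess t a ≤ excess t a * |a| := by
  rcases le_total |a| t with h | h
  · rw [excess, max_eq_right (by linarith)]
    simp
  · rw [mul_comm]
    exact mul_le_mul_of_nonneg_left h (excess_nonneg _ _)

lemma abs_sq_sub_clip_sq_le {t : ℝ} (ht : 0 ≤ t) (a : ℝ) :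
    |a ^ 2 - clip t a ^ 2| ≤ 2 * t * excess t a + excess t a ^ 2 := by
  have h1 := abs_sub_clip ht a
  have h2 := abs_clip_le ht a
  have e : a ^ 2 - clip t a ^ 2 = (a - clip t a) * (2 * clip t a) + (a - clip t a) ^ 2 := by ring
  rw [e]
  refine (abs_add_le _ _).trans ?_
  rw [abs_mul, abs_mul, abs_pow, h1, abs_two]
  nlinarith [excess_nonneg t a]

lemma continuous_clip (t : ℝ) : Continuous (clip t) := by unfold clip; fun_prop

lemma continuous_excess (t : ℝ) : Continuous (excess t) := by unfold excess; fun_prop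

/-- Used for `clip` and `excess`, which therefore inherit almost invariance. -/
lemma integral_sub_sq_le_of_lipschitz {φ : ℝ → ℝ}
    (hφ : ∀ a b, |φ a - φ b| ≤ |a - b|) {f : X → ℝ} (hf : MemLp f 2 P) (g : G) :
    ∫ x, (φ (f (g • x)) - φ (f x)) ^ 2 ∂P ≤ ∫ x, (f (g • x) - f x) ^ 2 ∂P :=
  integral_mono_of_nonneg (Eventually.of_forall fun _ => sq_nonneg _)
    ((hf.comp_measurePreserving (measurePreserving_smul g P)).sub hf).integrable_sq
    (Eventually.of_forall fun _ => sq_le_sq.2 (hφ _ _))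

lemma sq_integral_le [IsProbabilityMeasure P] {f : X → ℝ} (hf : MemLp f 2 P) :
    (∫ x, f x ∂P) ^ 2 ≤ ∫ x, f x ^ 2 ∂P := by
  simpa using sq_integral_mul_le hf (memLp_const (1 : ℝ))

/-- If nonnegative functions that are almost invariant under finitely many elements do not
concentrate, then there are no asymptotically invariant unit vectors with zero integral. -/
lemma AlmostInvariant.false_of_unit [IsProbabilityMeasure P] (herg : ErgodicModNull G P)
    {ι : Type*} [Fintype ι] {t : ι → G} {c : ℝ} (hc : 0 < c)
    (hK : ∀ v : X → ℝ, MemLp v 2 P → (∀ x, 0 ≤ v x) →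
      c * ∫ x, v x ^ 2 ∂P ≤ (∫ x, v x ∂P) ^ 2 + ∑ i, ∫ x, (v (t i • x) - v x) ^ 2 ∂P)
    {f : ℕ → X → ℝ} (hf : AlmostInvariant G P f) (hm : ∀ k, MemLp (f k) 2 P)
    (hf0 : ∀ k, ∫ x, f k x ∂P = 0) (hf1 : ∀ k, ∫ x, f k x ^ 2 ∂P = 1) : False := by
  -- At this level the squared integral of the excess is at most `c / 2` times its second moment, so
  -- half of the left side of the nonconcentration inequality absorbs it.
  set s := √(2 / c) with hs
  have hs2 : s ^ 2 = 2 / c := Real.sq_sqrt (by positivity)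
  have hspos : 0 < s := Real.sqrt_pos.2 (by positivity)
  have hvm : ∀ k, MemLp (fun x => excess s (f k x)) 2 P := fun k => by
    refine (hm k).mono ((continuous_excess s).comp_aestronglyMeasurable (hm k).1)
      (Eventually.of_forall fun x => ?_)
    rw [Real.norm_of_nonneg (excess_nonneg _ _), Real.norm_eq_abs]
    exact max_le (by linarith) (abs_nonneg _)
  have hgm : ∀ k, MemLp (fun x => clip s (f k x)) 2 P := fun k =>
    MemLp.of_bound ((continuous_clip s).comp_aestronglyMeasurable (hm k).1) s
      (Eventually.of_forall fun x => abs_clip_le hspos.le _)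
  have hgi : ∀ k, Integrable (fun x => clip s (f k x)) P := fun k =>
    (hgm k).integrable (by norm_num)
  have hvi : ∀ k, Integrable (fun x => excess s (f k x)) P := fun k =>
    (hvm k).integrable (by norm_num)
  have hfi : ∀ k, Integrable (f k) P := fun k => (hm k).integrable (by norm_num)
  have hv2 : Tendsto (fun k => ∫ x, excess s (f k x) ^ 2 ∂P) atTop (𝓝 0) := by
    have hD : Tendsto (fun k => 2 / c * ∑ i, ∫ x, (f k (t i • x) - f k x) ^ 2 ∂P) atTop
        (𝓝 0) := by
      simpa using (tendsto_finsetSum Finset.univ fun i _ => hf (t i)).const_mul (2 / c)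
    refine squeeze_zero (fun k => integral_nonneg fun x => sq_nonneg _) (fun k => ?_) hD
    have h1 := hK _ (hvm k) fun x => excess_nonneg _ _
    have h2 : (∫ x, excess s (f k x) ∂P) ^ 2 ≤ c / 2 * ∫ x, excess s (f k x) ^ 2 ∂P := by
      -- The excess is nonzero only where `|f k| > s`. Cauchy-Schwarz with `‖f k‖ = 1` then gives
      -- the bound.
      have h3 : s * ∫ x, excess s (f k x) ∂P ≤ ∫ x, excess s (f k x) * |f k x| ∂P := by
        rw [← integral_const_mul]
        exact integral_mono ((hvi k).const_mul s) ((hvm k).integrable_mul (hm k).abs)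
          fun x => mul_excess_le _
      have h4 := sq_integral_mul_le (hvm k) (hm k).abs
      have h4' : ∫ x, |f k| x ^ 2 ∂P = 1 := by
        simp only [Pi.abs_apply, sq_abs]
        exact hf1 k
      rw [h4', mul_one] at h4
      have h5 : 0 ≤ ∫ x, excess s (f k x) ∂P := integral_nonneg fun x => excess_nonneg _ _
      have h6 := (pow_le_pow_left₀ (mul_nonneg hspos.le h5) h3 2).trans h4
      rw [mul_pow, hs2] at h6
      have h7 := mul_le_mul_of_nonneg_left h6 (show 0 ≤ c / 2 by positivity)
      rwa [← mul_assoc, show c / 2 * (2 / c) = 1 by field_simp, one_mul] at h7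
    have h3 : ∑ i, ∫ x, (excess s (f k (t i • x)) - excess s (f k x)) ^ 2 ∂P ≤
        ∑ i, ∫ x, (f k (t i • x) - f k x) ^ 2 ∂P := Finset.sum_le_sum fun i _ =>
      integral_sub_sq_le_of_lipschitz (abs_excess_sub_excess_le s) (hm k) (t i)
    rw [div_mul_eq_mul_div, le_div_iff₀ hc]
    linarith
  have hv1 : Tendsto (fun k => ∫ x, excess s (f k x) ∂P) atTop (𝓝 0) := by
    have h1 := hv2.sqrt
    rw [Real.sqrt_zero] at h1
    exact squeeze_zero (fun k => integral_nonneg fun x => excess_nonneg _ _)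
      (fun k => Real.le_sqrt_of_sq_le (sq_integral_le (hvm k))) h1
  have hg1 : Tendsto (fun k => ∫ x, clip s (f k x) ∂P) atTop (𝓝 0) := by
    refine squeeze_zero_norm (fun k => ?_) hv1
    have h1 : ∫ x, clip s (f k x) ∂P = -∫ x, (f k x - clip s (f k x)) ∂P := by
      rw [integral_sub (hfi k) (hgi k), hf0]
      ring
    rw [h1, norm_neg]
    refine (norm_integral_le_integral_norm _).trans_eq ?_
    exact integral_congr_ae (Eventually.of_forall fun x => abs_sub_clip hspos.le _)
  have hg2 : Tendsto (fun k => ∫ x, clip s (f k x) ^ 2 ∂P) atTop (𝓝 1) := by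
    rw [tendsto_iff_norm_sub_tendsto_zero]
    have h0 : Tendsto (fun k => 2 * s * ∫ x, excess s (f k x) ∂P +
        ∫ x, excess s (f k x) ^ 2 ∂P) atTop (𝓝 0) := by
      simpa using (hv1.const_mul (2 * s)).add hv2
    refine squeeze_zero (fun k => norm_nonneg _) (fun k => ?_) h0
    rw [← hf1 k, norm_sub_rev, ← integral_sub (hm k).integrable_sq (hgm k).integrable_sq,
      ← integral_const_mul, ← integral_add ((hvi k).const_mul _) (hvm k).integrable_sq]
    exact (norm_integral_le_integral_norm _).trans
      (integral_mono_of_nonneg (Eventually.of_forall fun x => norm_nonneg _)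
        (((hvi k).const_mul _).add (hvm k).integrable_sq)
        (Eventually.of_forall fun x => abs_sq_sub_clip_sq_le hspos.le _))
  -- The interval `[-s, s]` is mapped affinely onto `[0, 1]`. The limiting mean is `1 / 2`, and the
  -- limiting variance `1 / (4 s²)` is positive.
  set u : ℕ → X → ℝ := fun k x => (2 * s)⁻¹ * (clip s (f k x) + s) with hu
  have hum : ∀ k, AEStronglyMeasurable (u k) P := fun k =>
    ((hgm k).1.add aestronglyMeasurable_const).const_mul _
  have huI : ∀ k x, u k x ∈ Set.Icc (0 : ℝ) 1 := by
    intro k x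
    have h1 := abs_le.1 (abs_clip_le hspos.le (f k x))
    refine ⟨mul_nonneg (by positivity) (by linarith), ?_⟩
    simp only [hu]
    rw [inv_mul_le_iff₀ (by positivity)]
    linarith
  have huinv : AlmostInvariant G P u := by
    intro g
    have h1 := (hf g).const_mul ((2 * s)⁻¹ ^ 2)
    rw [mul_zero] at h1
    refine squeeze_zero (fun k => integral_nonneg fun x => sq_nonneg _) (fun k => ?_) h1
    have h2 := mul_le_mul_of_nonneg_left
      (integral_sub_sq_le_of_lipschitz (abs_clip_sub_clip_le s) (hm k) g)
      (sq_nonneg (2 * s)⁻¹)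
    refine le_trans (le_of_eq ?_) h2
    rw [← integral_const_mul]
    exact integral_congr_ae (Eventually.of_forall fun x => by simp only [hu]; ring)
  have hu1 : Tendsto (fun k => ∫ x, u k x ∂P) atTop (𝓝 2⁻¹) := by
    have h1 := (hg1.add_const s).const_mul (2 * s)⁻¹
    rw [show (2 * s)⁻¹ * (0 + s) = 2⁻¹ by field_simp; ring] at h1
    refine h1.congr fun k => ?_
    simp only [hu]
    rw [integral_const_mul, integral_add (hgi k) (integrable_const _)]
    simp
  have hu2 : Tendsto (fun k => ∫ x, u k x ^ 2 ∂P) atTop (𝓝 ((2 * s)⁻¹ ^ 2 + 4⁻¹)) := by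
    have h1 := ((hg2.add (hg1.const_mul (2 * s))).add_const (s ^ 2)).const_mul ((2 * s)⁻¹ ^ 2)
    rw [show (2 * s)⁻¹ ^ 2 * (1 + 2 * s * 0 + s ^ 2) = (2 * s)⁻¹ ^ 2 + 4⁻¹ by
      field_simp; ring] at h1
    refine h1.congr fun k => ?_
    have h2 : ∀ x, u k x ^ 2 =
        (2 * s)⁻¹ ^ 2 * (clip s (f k x) ^ 2 + 2 * s * clip s (f k x) + s ^ 2) := fun x => by
      simp only [hu]; ring
    have h3 : Integrable (fun x => clip s (f k x) ^ 2 + 2 * s * clip s (f k x)) P :=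
      (hgm k).integrable_sq.add ((hgi k).const_mul _)
    simp_rw [h2]
    rw [integral_const_mul, integral_add h3 (integrable_const _),
      integral_add (hgm k).integrable_sq ((hgi k).const_mul _), integral_const_mul]
    simp
  have := huinv.second_moment_le herg hc hK hum huI hu1 hu2
  have hpos : 0 < (2 * s)⁻¹ ^ 2 := by positivity
  norm_num at this
  nlinarith

/-- Together with the inverse version below, this passes almost invariance from generators to the
group. -/
lemma integral_comp_mul_sub_sq_le {g h : G} {f : X → ℝ} (hf : MemLp f 2 P) :
    ∫ x, (f ((g * h) • x) - f x) ^ 2 ∂P ≤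
      2 * ∫ x, (f (g • x) - f x) ^ 2 ∂P + 2 * ∫ x, (f (h • x) - f x) ^ 2 ∂P := by
  have hg : MemLp (fun x => f (g • x) - f x) 2 P :=
    (hf.comp_measurePreserving (measurePreserving_smul g P)).sub hf
  have hh : MemLp (fun x => f (h • x) - f x) 2 P :=
    (hf.comp_measurePreserving (measurePreserving_smul h P)).sub hf
  have hgh : MemLp (fun x => f (g • h • x) - f (h • x)) 2 P :=
    hg.comp_measurePreserving (measurePreserving_smul h P)
  rw [← integral_comp_sq (measurePreserving_smul h P) hg, ← integral_const_mul,
    ← integral_const_mul,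
    ← integral_add (hgh.integrable_sq.const_mul 2) (hh.integrable_sq.const_mul 2)]
  refine integral_mono_of_nonneg (Eventually.of_forall fun x => sq_nonneg _)
    ((hgh.integrable_sq.const_mul 2).add (hh.integrable_sq.const_mul 2))
    (Eventually.of_forall fun x => ?_)
  show (f ((g * h) • x) - f x) ^ 2 ≤
    2 * (f (g • h • x) - f (h • x)) ^ 2 + 2 * (f (h • x) - f x) ^ 2
  rw [mul_smul]
  nlinarith [sq_nonneg ((f (g • h • x) - f (h • x)) - (f (h • x) - f x))]

lemma integral_comp_inv_sub_sq {g : G} {f : X → ℝ} (hf : MemLp f 2 P) :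
    ∫ x, (f (g⁻¹ • x) - f x) ^ 2 ∂P = ∫ x, (f (g • x) - f x) ^ 2 ∂P := by
  have hg : MemLp (fun x => f (g⁻¹ • x) - f x) 2 P :=
    (hf.comp_measurePreserving (measurePreserving_smul g⁻¹ P)).sub hf
  rw [← integral_comp_sq (measurePreserving_smul g P) hg]
  refine integral_congr_ae (Eventually.of_forall fun x => ?_)
  simp only [inv_smul_smul]
  ring

end Gap

/-! ### From absence of almost invariant vectors to a spectral gap -/

section SpectralGap

open scoped Topology
open Filter

variable {Γ X : Type*} [Group Γ] [MulAction Γ X] [MeasurableSpace X]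
  {P : Measure X}

/-- The right side is the sum over all group elements of terms like the left side, and all these
terms are nonnegative. -/
lemma toReal_mul_integral_le [Countable Γ] {p : PMF Γ}
    (hp : ∀ g ∈ p.support, MeasurePreserving (fun x : X => g • x) P P) {f : X → ℝ}
    (hf : MemLp f 2 P) {g : Γ} (hg : g ∈ p.support) :
    (p g).toReal * ∫ x, (f (g • x) - f x) ^ 2 ∂P ≤
      2 * (∫ x, f x ^ 2 ∂P - ∫ x, avg p f x * f x ∂P) := by
  rw [integral_comp_sub_sq (hp g hg) hf]
  have h1 : HasSum (fun g => (p g).toReal * (∫ x, f x ^ 2 ∂P - ∫ x, f (g • x) * f x ∂P))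
      (∫ x, f x ^ 2 ∂P - ∫ x, avg p f x * f x ∂P) := by
    rw [integral_avg_mul hp hf]
    have h2 := ((hasSum_toReal p).mul_right (∫ x, f x ^ 2 ∂P)).sub
      (summable_expect_integral hp hf).hasSum
    rw [one_mul] at h2
    simpa only [mul_sub, expect] using h2
  have h3 := le_hasSum h1 g fun b _ => by
    by_cases hb : b ∈ p.support
    · exact mul_nonneg ENNReal.toReal_nonneg
        (sub_nonneg.2 (abs_le.1 (abs_integral_comp_mul_le (hp b hb) hf)).2)
    · simp [(PMF.apply_eq_zero_iff p b).2 hb]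
  linarith

lemma exists_unit_of_one_le_topSpectrum {p : PMF Γ} (h1 : 1 ≤ topSpectrum P p) {ε : ℝ}
    (hε : 0 < ε) :
    ∃ f : X → ℝ, MemLp f 2 P ∧ ∫ x, f x ∂P = 0 ∧ ∫ x, f x ^ 2 ∂P = 1 ∧
      1 - ε < ∫ x, avg p f x * f x ∂P := by
  -- An empty supremum would be `0`, which is below `1`.
  have hne : {r : ℝ | ∃ f : X → ℝ, MemLp f 2 P ∧ ∫ x, f x ∂P = 0 ∧ ¬ f =ᵐ[P] 0 ∧
      r = (∫ x, avg p f x * f x ∂P) / ∫ x, f x ^ 2 ∂P}.Nonempty := by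
    by_contra! hempty
    rw [topSpectrum, hempty, Real.sSup_empty] at h1
    linarith
  obtain ⟨r, ⟨f, hf, hf0, hfne, rfl⟩, hr⟩ := exists_lt_of_lt_csSup hne
    (show 1 - ε < topSpectrum P p by linarith)
  have hN := integral_sq_pos hf hfne
  set N := ∫ x, f x ^ 2 ∂P
  have hs : (√N)⁻¹ * (√N)⁻¹ = N⁻¹ := by rw [← mul_inv, Real.mul_self_sqrt hN.le]
  refine ⟨fun x => (√N)⁻¹ * f x, hf.const_mul _, ?_, ?_, ?_⟩
  · rw [integral_const_mul, hf0, mul_zero]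
  · simp_rw [mul_pow]
    rw [integral_const_mul, sq, hs, inv_mul_cancel₀ hN.ne']
  · have h2 : ∀ x, avg p (fun x => (√N)⁻¹ * f x) x * ((√N)⁻¹ * f x) =
        N⁻¹ * (avg p f x * f x) := by
      intro x
      have h3 : avg p (fun x => (√N)⁻¹ * f x) x = (√N)⁻¹ * avg p f x := by
        rw [avg, avg, ← tsum_mul_left]
        exact tsum_congr fun g => by ring
      rw [h3, ← hs]
      ring
    simp_rw [h2]
    rwa [integral_const_mul, inv_mul_eq_div]

/-- An ergodic action has spectral gap if nonnegative functions that are almost invariant under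
finitely many elements do not concentrate. -/
lemma topSpectrum_lt_one [Countable Γ] [MeasurableConstSMul Γ X] [IsProbabilityMeasure P] {K : Subgroup Γ}
    [SMulInvariantMeasure K X P] (herg : ErgodicModNull K P) {ι : Type*} [Fintype ι]
    {t : ι → K} {c : ℝ} (hc : 0 < c)
    (hK : ∀ v : X → ℝ, MemLp v 2 P → (∀ x, 0 ≤ v x) →
      c * ∫ x, v x ^ 2 ∂P ≤ (∫ x, v x ∂P) ^ 2 + ∑ i, ∫ x, (v (t i • x) - v x) ^ 2 ∂P)
    {p : PMF Γ} (hp : Subgroup.closure p.support = K) : topSpectrum P p < 1 := by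
  by_contra! hle
  have hpres : ∀ g ∈ p.support, MeasurePreserving (fun x : X => g • x) P P := fun g hg =>
    measurePreserving_smul (⟨g, hp ▸ Subgroup.subset_closure hg⟩ : K) P
  -- Near-maximizers of the Rayleigh quotient are almost invariant under each element of the
  -- support, hence under `K`.
  choose f hf hf0 hf1 hfε using fun k : ℕ =>
    exists_unit_of_one_le_topSpectrum hle (ε := 1 / ((k : ℝ) + 1)) (by positivity)
  have hgen : ∀ g ∈ p.support,
      Tendsto (fun k => ∫ x, (f k (g • x) - f k x) ^ 2 ∂P) atTop (𝓝 0) := by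
    intro g hg
    have hpg : 0 < (p g).toReal :=
      ENNReal.toReal_pos ((PMF.mem_support_iff p g).1 hg) (p.apply_ne_top g)
    have hlim := (tendsto_one_div_add_atTop_nhds_zero_nat (𝕜 := ℝ)).const_mul
      ((p g).toReal⁻¹ * 2)
    rw [mul_zero] at hlim
    refine squeeze_zero (fun k => integral_nonneg fun x => sq_nonneg _) (fun k => ?_) hlim
    have h1 := toReal_mul_integral_le hpres (hf k) hg
    rw [hf1 k] at h1
    rw [mul_assoc, le_inv_mul_iff₀ hpg]
    linarith [hfε k]
  have hinv : AlmostInvariant K P f := by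
    rintro ⟨g, hgK⟩
    have hg : g ∈ Subgroup.closure p.support := by rwa [hp]
    have hcl : ∀ g (hg : g ∈ Subgroup.closure p.support),
        Tendsto (fun k => ∫ x, (f k (g • x) - f k x) ^ 2 ∂P) atTop (𝓝 0) := by
      intro g hg
      induction hg using Subgroup.closure_induction with
      | mem g hg => exact hgen g hg
      | one => simp
      | mul g h hg hh ihg ihh =>
        have hlim := (ihg.const_mul 2).add (ihh.const_mul 2)
        rw [mul_zero, add_zero] at hlim
        exact squeeze_zero (fun k => integral_nonneg fun x => sq_nonneg _)
          (fun k => integral_comp_mul_sub_sq_le (g := (⟨g, hp ▸ hg⟩ : K))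
            (h := (⟨h, hp ▸ hh⟩ : K)) (hf k)) hlim
      | inv g hg ih =>
        refine ih.congr fun k => ?_
        exact (integral_comp_inv_sub_sq (g := (⟨g, hp ▸ hg⟩ : K)) (hf k)).symm
    exact hcl g hg
  exact hinv.false_of_unit herg hc hK hf hf0 hf1

end SpectralGap

/-! ### Ergodic components and conditional measures -/

section Components

variable {Γ X : Type*} [Group Γ] [MulAction Γ X] [MeasurableSpace X] {μ : Measure X}
  {K : Subgroup Γ}

lemma IsInvariant.diff {Y Z : Set X} (hY : IsInvariant μ K Y) (hZ : IsInvariant μ K Z) :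
    IsInvariant μ K (Y \ Z) :=
  ⟨hY.1.diff hZ.1, fun g hg => by
    rw [Set.preimage_sdiff]
    exact (hY.2 g hg).diff (hZ.2 g hg)⟩

lemma isInvariant_univ : IsInvariant μ K Set.univ :=
  ⟨MeasurableSet.univ, fun _ _ => Filter.EventuallyEq.rfl⟩

/-- A nonergodic set splits into two invariant pieces of measure at least `c`, so each piece has
lost at least `c` and the bound `N` drops by one. Splitting into `Z` and `Y \ Z` keeps the union
exact. -/
lemma exists_finite_components [IsFiniteMeasure μ] {c : ℝ} (hc : 0 < c)
    (hlow : ∀ Y, IsInvariant μ K Y → 0 < μ Y → c ≤ μ.real Y) (N : ℕ) {Y : Set X}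
    (hY : IsInvariant μ K Y) (hpos : 0 < μ Y) (hN : μ.real Y ≤ N * c) :
    ∃ C : Set (Set X), C.Finite ∧ C.PairwiseDisjoint id ∧ ⋃₀ C = Y ∧
      ∀ Z ∈ C, IsErgodicComponent μ K Z := by
  induction N generalizing Y with
  | zero =>
    have := hlow Y hY hpos
    simp only [Nat.cast_zero, zero_mul] at hN
    linarith
  | succ N ih =>
    by_cases herg : ∀ Z : Set X, Z ⊆ Y → IsInvariant μ K Z → μ Z = 0 ∨ μ (Y \ Z) = 0
    · exact ⟨{Y}, Set.finite_singleton _, Set.pairwiseDisjoint_singleton _ _,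
        Set.sUnion_singleton _, by rintro Z rfl; exact ⟨hY, hpos, herg⟩⟩
    · push Not at herg
      obtain ⟨Z, hZY, hZ, hZ0, hYZ0⟩ := herg
      have hadd : μ.real Z + μ.real (Y \ Z) = μ.real Y := by
        rw [← measureReal_sdiff_add_inter (s := Y) hZ.1, Set.inter_eq_self_of_subset_right hZY,
          add_comm]
      have h1 := hlow Z hZ (pos_iff_ne_zero.2 hZ0)
      have h2 := hlow _ (hY.diff hZ) (pos_iff_ne_zero.2 hYZ0)
      push_cast at hN
      obtain ⟨C, hCf, hCd, hCu, hCe⟩ := ih hZ (pos_iff_ne_zero.2 hZ0) (by linarith)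
      obtain ⟨D, hDf, hDd, hDu, hDe⟩ := ih (hY.diff hZ) (pos_iff_ne_zero.2 hYZ0) (by linarith)
      refine ⟨C ∪ D, hCf.union hDf, ?_, ?_, ?_⟩
      · refine hCd.union hDd fun A hA B hB _ => ?_
        refine Set.disjoint_of_subset (s₂ := Z) (t₂ := Y \ Z) ?_ ?_ Set.disjoint_sdiff_right
        · rw [← hCu]; exact Set.subset_sUnion_of_mem hA
        · rw [← hDu]; exact Set.subset_sUnion_of_mem hB
      · rw [Set.sUnion_union, hCu, hDu, Set.union_sdiff_cancel hZY]
      · rintro A (hA | hA)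
        exacts [hCe A hA, hDe A hA]

lemma exists_fin_components [IsProbabilityMeasure μ] {c : ℝ} (hc : 0 < c)
    (hlow : ∀ Y, IsInvariant μ K Y → 0 < μ Y → c ≤ μ.real Y) :
    ∃ (m : ℕ) (Y : Fin m → Set X), Pairwise (fun i j => Disjoint (Y i) (Y j)) ∧
      (⋃ i, Y i) = Set.univ ∧ ∀ i, IsErgodicComponent μ K (Y i) := by
  obtain ⟨N, hN⟩ := exists_nat_ge (1 / c)
  obtain ⟨C, hf, hd, hu, he⟩ := exists_finite_components hc hlow N isInvariant_univ (by simp)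
    (by rw [div_le_iff₀ hc] at hN; simpa using hN)
  have := hf.fintype
  let e := Fintype.equivFin C
  refine ⟨Fintype.card C, fun i => (e.symm i : Set X), fun i j hij => ?_, ?_, fun i =>
    he _ (e.symm i).2⟩
  · exact hd (e.symm i).2 (e.symm j).2 fun h => hij (e.symm.injective (Subtype.ext h))
  · rw [← hu, Set.sUnion_eq_iUnion]
    exact e.symm.surjective.iUnion_comp fun A : C => (A : Set X)

lemma integral_cond (Y : Set X) (f : X → ℝ) :
    ∫ x, f x ∂(ProbabilityTheory.cond μ Y) = (μ.real Y)⁻¹ * ∫ x in Y, f x ∂μ := by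
  rw [ProbabilityTheory.cond, integral_smul_measure, ENNReal.toReal_inv]
  rfl

lemma ae_cond_iff [IsFiniteMeasure μ] {Y : Set X} (hY : MeasurableSet Y) {q : X → Prop} :
    (∀ᵐ x ∂(ProbabilityTheory.cond μ Y), q x) ↔ ∀ᵐ x ∂μ, x ∈ Y → q x := by
  rw [ProbabilityTheory.cond, Measure.ae_ennreal_smul_measure_iff (by simp), ae_restrict_iff' hY]

lemma measurePreserving_cond [MeasurableConstSMul Γ X] [SMulInvariantMeasure Γ X μ] {Y : Set X}
    (hY : IsInvariant μ K Y) {g : Γ} (hg : g ∈ K) :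
    MeasurePreserving (fun x : X => g • x) (ProbabilityTheory.cond μ Y)
      (ProbabilityTheory.cond μ Y) := by
  have h := (measurePreserving_smul g μ).restrict_preimage hY.1
  rw [Measure.restrict_congr_set (hY.2 g hg)] at h
  exact h.smul_measure _

/-- A set invariant for the conditional measure need not be invariant for `μ`, but its intersection
with `Y` is. -/
lemma ergodicModNull_cond [IsFiniteMeasure μ] {Y : Set X} (hY : IsErgodicComponent μ K Y) :
    ErgodicModNull K (ProbabilityTheory.cond μ Y) := by
  intro Z hZ hinv
  have hYm := hY.1.1
  have hYZ : IsInvariant μ K (Y ∩ Z) := by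
    refine ⟨hYm.inter hZ, fun g hg => ?_⟩
    have h1 := (ae_cond_iff hYm).1 (hinv ⟨g, hg⟩).mem_iff
    filter_upwards [h1, (hY.1.2 g hg).mem_iff] with x hx1 hx2
    refine propext ?_
    change g • x ∈ Y ∧ g • x ∈ Z ↔ x ∈ Y ∧ x ∈ Z
    change g • x ∈ Y ↔ x ∈ Y at hx2
    change x ∈ Y → (g • x ∈ Z ↔ x ∈ Z) at hx1
    tauto
  rcases hY.2.2 _ Set.inter_subset_left hYZ with h | h
  · left
    rw [ProbabilityTheory.cond_apply hYm, h, mul_zero]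
  · right
    rw [Set.sdiff_self_inter] at h
    rw [ProbabilityTheory.cond_apply hYm, ← Set.sdiff_eq_compl_inter.trans (Set.inter_comm _ _), h,
      mul_zero]

variable [MeasurableConstSMul Γ X] [SMulInvariantMeasure Γ X μ]

/-- Nonconcentration of almost invariant functions gives finitely many ergodic components with
spectral gap. -/
lemma finitelyManyComponentsWithGap_of_nonconcentration [Countable Γ] [IsProbabilityMeasure μ]
    {T : Finset Γ} (hT : ∀ h ∈ T, h ∈ K) {c : ℝ} (hc : 0 < c)
    (hK : ∀ v : X → ℝ, MemLp v 2 μ → (∀ x, 0 ≤ v x) →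
      c * ∫ x, v x ^ 2 ∂μ ≤ (∫ x, v x ∂μ) ^ 2 + ∑ h ∈ T, ∫ x, (v (h • x) - v x) ^ 2 ∂μ) :
    FinitelyManyComponentsWithGap μ K := by
  -- The inequality localizes to `Y` by extending `v` by zero, since elements of `K` preserve `Y`
  -- modulo null sets.
  have key : ∀ Y : Set X, IsInvariant μ K Y → ∀ v : X → ℝ, MemLp v 2 (μ.restrict Y) →
      (∀ x, 0 ≤ v x) → c * ∫ x in Y, v x ^ 2 ∂μ ≤
        (∫ x in Y, v x ∂μ) ^ 2 + ∑ h ∈ T, ∫ x in Y, (v (h • x) - v x) ^ 2 ∂μ := by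
    intro Y hY v hv hv0
    have h1 := hK (Y.indicator v) ((memLp_indicator_iff_restrict hY.1).2 hv)
      fun x => Set.indicator_nonneg (fun x _ => hv0 x) x
    have e1 : ∫ x, Y.indicator v x ^ 2 ∂μ = ∫ x in Y, v x ^ 2 ∂μ := by
      rw [← integral_indicator hY.1]
      refine integral_congr_ae (Filter.Eventually.of_forall fun x => ?_)
      by_cases hx : x ∈ Y <;> simp [hx]
    have e2 : ∀ h ∈ T, ∫ x, (Y.indicator v (h • x) - Y.indicator v x) ^ 2 ∂μ =
        ∫ x in Y, (v (h • x) - v x) ^ 2 ∂μ := by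
      intro h hh
      rw [← integral_indicator hY.1]
      refine integral_congr_ae ?_
      filter_upwards [(hY.2 h (hT h hh)).mem_iff] with x hx
      change h • x ∈ Y ↔ x ∈ Y at hx
      by_cases hxY : x ∈ Y
      · simp [hxY, hx.2 hxY]
      · simp [hxY, mt hx.1 hxY]
    rwa [e1, integral_indicator hY.1, Finset.sum_congr rfl e2] at h1
  -- With `v = 1` the displacements vanish and `c μ(Y) ≤ μ(Y)²` remains.
  have hlow : ∀ Y, IsInvariant μ K Y → 0 < μ Y → c ≤ μ.real Y := by
    intro Y hY hpos
    have hpos' : 0 < μ.real Y := ENNReal.toReal_pos hpos.ne' (measure_ne_top μ Y)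
    have h1 := key Y hY (fun _ => 1) (memLp_const 1) fun _ => zero_le_one
    simp only [one_pow, sub_self, ne_eq, OfNat.ofNat_ne_zero, not_false_eq_true, zero_pow,
      integral_const, measureReal_restrict_apply_univ, smul_eq_mul, mul_one, mul_zero,
      Finset.sum_const_zero, add_zero] at h1
    nlinarith
  obtain ⟨m, Y, hd, hu, he⟩ := exists_fin_components hc hlow
  refine ⟨m, Y, hd, hu, fun i => ⟨he i, fun p _ hp => ?_⟩⟩
  have hY := (he i).1
  have hpos := (he i).2.1
  have hpos' : 0 < μ.real (Y i) := ENNReal.toReal_pos hpos.ne' (measure_ne_top μ _)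
  have : IsProbabilityMeasure (ProbabilityTheory.cond μ (Y i)) :=
    ProbabilityTheory.cond_isProbabilityMeasure hpos.ne'
  have : SMulInvariantMeasure K X (ProbabilityTheory.cond μ (Y i)) :=
    ⟨fun g s hs => (measurePreserving_cond hY g.2).measure_preimage hs.nullMeasurableSet⟩
  refine topSpectrum_lt_one (ergodicModNull_cond (he i))
    (t := fun h : T => (⟨h, hT h h.2⟩ : K)) hc (fun v hv hv0 => ?_) hp
  have hvr : MemLp v 2 (μ.restrict (Y i)) := by
    have h1 := hv.smul_measure (c := μ (Y i)) (measure_ne_top μ _)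
    rwa [ProbabilityTheory.cond, smul_smul,
      ENNReal.mul_inv_cancel hpos.ne' (measure_ne_top μ _), one_smul] at h1
  have h1 := key (Y i) hY v hvr hv0
  change _ ≤ _ + ∑ h : T, ∫ x, (v ((h : Γ) • x) - v x) ^ 2 ∂_
  rw [Finset.sum_coe_sort T
    (fun h : Γ => ∫ x, (v (h • x) - v x) ^ 2 ∂(ProbabilityTheory.cond μ (Y i)))]
  simp_rw [integral_cond]
  rw [← Finset.mul_sum]
  set M := μ.real (Y i)
  have hM1 : M ≤ 1 := measureReal_le_one
  -- Normalization multiplies the second moment and the displacements by `M⁻¹`, but the squared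
  -- integral by `M⁻²`, which is at least as large. The inequality thus keeps its constant `c`.
  have h2 : 1 ≤ M⁻¹ := (one_le_inv₀ hpos').2 hM1
  have h3 := mul_le_mul_of_nonneg_left h1 (inv_nonneg.2 hpos'.le)
  have h4 := mul_le_mul_of_nonneg_right h2 (mul_nonneg (inv_nonneg.2 hpos'.le)
    (sq_nonneg (∫ x in Y i, v x ∂μ)))
  rw [mul_pow]
  nlinarith

end Components

/-! ### Comparing a walk with its lazy version -/

section Radius

variable {Γ A : Type*} [Group Γ] [Countable Γ] [MulAction Γ A] [MeasurableSpace A]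
  {m : Measure A}

lemma integral_avg_lazy_mul {p : PMF Γ}
    (hp : ∀ g : Γ, MeasurePreserving (fun x : A => g • x) m m) {f : A → ℝ} (hf : MemLp f 2 m) :
    ∫ x, avg (lazy p) f x * f x ∂m =
      2⁻¹ * ∫ x, avg p f x * f x ∂m + 2⁻¹ * ∫ x, f x ^ 2 ∂m := by
  rw [integral_avg_mul (fun g _ => hp g) hf, integral_avg_mul (fun g _ => hp g) hf,
    expect_lazy (summable_expect_integral (fun g _ => hp g) hf)]
  simp_rw [one_smul, sq]

/-- Rayleigh quotients `r` become `(r + 1) / 2`. Only an inequality is claimed: if there are no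
nonzero mean-zero functions, both suprema are `0` by convention and equality fails. -/
lemma topSpectrum_lazy_le {p : PMF Γ} (hp : ∀ g : Γ, MeasurePreserving (fun x : A => g • x) m m) :
    2 * topSpectrum m (lazy p) - 1 ≤ topSpectrum m p := by
  have hle : ∀ f : A → ℝ, MemLp f 2 m → ∫ x, f x ∂m = 0 → ¬ f =ᵐ[m] 0 →
      (∫ x, avg p f x * f x ∂m) / ∫ x, f x ^ 2 ∂m ≤ topSpectrum m p := fun f hf hf0 h0 =>
    le_csSup (bddAbove_topSpectrum fun g _ => hp g) ⟨f, hf, hf0, h0, rfl⟩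
  have hbound : topSpectrum m (lazy p) ≤ 2⁻¹ * topSpectrum m p + 2⁻¹ := by
    refine Real.sSup_le ?_ ?_
    · rintro r ⟨f, hf, hf0, h0, rfl⟩
      have hN := integral_sq_pos hf h0
      rw [integral_avg_lazy_mul hp hf, add_div, mul_div_assoc, mul_div_assoc, div_self hN.ne',
        mul_one]
      have := hle f hf hf0 h0
      linarith
    -- Because of the convention for empty suprema, the bound must also be shown nonnegative; any
    -- single quotient is at least `-1`.
    · by_cases hex : ∃ f : A → ℝ, MemLp f 2 m ∧ ∫ x, f x ∂m = 0 ∧ ¬ f =ᵐ[m] 0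
      · obtain ⟨f, hf, hf0, h0⟩ := hex
        have hN := integral_sq_pos hf h0
        have h1 := (abs_le.1 (abs_integral_avg_mul_le (p := p) (fun g _ => hp g) hf)).1
        have h2 : -1 ≤ (∫ x, avg p f x * f x ∂m) / ∫ x, f x ^ 2 ∂m := by
          rw [le_div_iff₀ hN]
          linarith
        linarith [hle f hf hf0 h0]
      · have : topSpectrum m p = 0 := by
          rw [topSpectrum]
          convert Real.sSup_empty
          refine Set.eq_empty_of_forall_notMem ?_
          rintro r ⟨f, hf, hf0, h0, -⟩
          exact hex ⟨f, hf, hf0, h0⟩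
        rw [this]
        norm_num
  linarith

end Radius

/-! ### The relative spectral radius via counting measure on the coset space -/

section CosetSpace

variable {Γ : Type*} [Group Γ]

lemma integral_count_eq_tsum {A : Type*} [Countable A] [MeasurableSpace A]
    [MeasurableSingletonClass A] (f : A → ℝ) : ∫ x, f x ∂Measure.count = ∑' x, f x := by
  by_cases hf : Integrable f Measure.count
  · rw [integral_countable hf]
    simp
  · rw [integral_undef hf, tsum_eq_zero_of_not_summable]
    rwa [integrable_count_iff, summable_norm_iff] at hf

lemma memLp_count_of_memℓp {A : Type*} [Countable A] [MeasurableSpace A]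
    [MeasurableSingletonClass A] {f : A → ℝ} (hf : Memℓp f 2) : MemLp f 2 Measure.count := by
  have hm : AEStronglyMeasurable f Measure.count := (measurable_of_countable f).aestronglyMeasurable
  rw [memLp_two_iff_integrable_sq hm, integrable_count_iff]
  have := (memℓp_gen_iff (by norm_num)).1 hf
  simpa using this

/-- If the even return probabilities to `H` of the lazy random walk decay at rate `ρ`, then the
relative spectral radius is bounded accordingly. -/
lemma relSpectralRadius_le_of_return_le {S : Finset Γ} (hne : S.Nonempty)
    (hS : ∀ s ∈ S, s⁻¹ ∈ S) (hgen : Subgroup.closure (S : Set Γ) = ⊤) (H : Subgroup Γ) {ρ : ℝ}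
    (hρ : 0 ≤ ρ)
    (h : ∀ n, Even n → returnProb (lazy (PMF.uniformOfFinset S hne)) H n ≤ ρ ^ n) :
    relSpectralRadius H (PMF.uniformOfFinset S hne) ≤ 2 * ρ - 1 := by
  classical
  have : Countable Γ := countable_of_closure_eq_top hgen
  have : Countable (Γ ⧸ H) := Quotient.countable
  let _ : MeasurableSpace (Γ ⧸ H) := ⊤
  have : DiscreteMeasurableSpace (Γ ⧸ H) := ⟨fun _ => trivial⟩
  have : MeasurableConstSMul Γ (Γ ⧸ H) := ⟨fun g => .of_discrete⟩
  have : SMulInvariantMeasure Γ (Γ ⧸ H) Measure.count := ⟨fun g s _ => by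
    rw [Measure.count_apply .of_discrete, Measure.count_apply .of_discrete, Set.preimage_smul,
      Set.encard_smul_set]⟩
  have hpres : ∀ g : Γ, MeasurePreserving (fun x : Γ ⧸ H => g • x) Measure.count Measure.count :=
    fun g => measurePreserving_smul g _
  have hnorm := norm_lazyAvg_le_of_return_le hne hS hgen ((1 : Γ) : Γ ⧸ H) hρ fun n hn => by
    refine le_trans (le_of_eq ?_) (h n hn)
    rw [returnProb_eq_expect]
    congr 1
    funext g
    -- The stabilizer of the trivial coset is `H`, so returning to this coset means that the walk is
    -- in `H`.
    have hg : g • ((1 : Γ) : Γ ⧸ H) = ((1 : Γ) : Γ ⧸ H) ↔ g ∈ H := by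
      rw [← QuotientGroup.mk_mul_of_mem 1 (one_mem H), eq_comm]
      rw [MulAction.Quotient.smul_coe, QuotientGroup.eq]
      simp
    by_cases hgH : g ∈ H
    · rw [Set.indicator_of_mem (Set.mem_singleton_iff.2 (hg.2 hgH)), if_pos hgH]
    · rw [Set.indicator_of_notMem (mt Set.mem_singleton_iff.1 (mt hg.1 hgH)), if_neg hgH]
  -- The point mass shows that the set of quotients is nonempty.
  refine csSup_le ⟨_, Pi.single ((1 : Γ) : Γ ⧸ H) 1, ?_, ?_, rfl⟩ ?_
  · refine memℓp_gen (summable_of_hasFiniteSupport ?_)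
    refine (Set.finite_singleton ((1 : Γ) : Γ ⧸ H)).subset fun x hx => ?_
    by_contra hx1
    exact hx (by simp [Pi.single_eq_of_ne hx1])
  · simp
  · rintro r ⟨f, hf, hf0, rfl⟩
    have hfm := memLp_count_of_memℓp hf
    rw [← integral_count_eq_tsum, ← integral_count_eq_tsum]
    have hN : 0 < ∫ c, f c ^ 2 ∂Measure.count := integral_sq_pos hfm fun h0 =>
      hf0 (funext fun x => Measure.ae_count_iff.1 h0 x)
    rw [div_le_iff₀ hN]
    set F := hfm.toLp f
    have hF : (F : Γ ⧸ H → ℝ) = f := funext fun x => Measure.ae_count_iff.1 hfm.coeFn_toLp x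
    have h1 := integral_avg_lazy_mul (p := PMF.uniformOfFinset S hne) hpres hfm
    have h2 := integral_avg_lazy_eq_inner hne F
    have h3 := norm_sq_eq_integral F
    rw [hF] at h2 h3
    have h4 := (real_inner_le_norm (lazyAvg Measure.count S F) F).trans
      (mul_le_mul_of_nonneg_right (hnorm F) (norm_nonneg F))
    rw [← h2, h1, mul_assoc, ← sq, h3] at h4
    linarith

end CosetSpace

end SpectralAction

end

theorem theorem1 {Γ : Type*} [Group Γ] (S : Finset Γ) (hne : S.Nonempty)
    (hsymm : ∀ s ∈ S, s⁻¹ ∈ S) (hgen : Subgroup.closure (S : Set Γ) = ⊤)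
    {X : Type*} [MeasurableSpace X] [StandardBorelSpace X]
    (μ : Measure X) [IsProbabilityMeasure μ]
    [MulAction Γ X] [MeasurableConstSMul Γ X] [SMulInvariantMeasure Γ X μ]
    (H : Subgroup Γ)
    (hH : SpectralAction.topSpectrum μ (PMF.uniformOfFinset S hne) <
      SpectralAction.relSpectralRadius H (PMF.uniformOfFinset S hne)) :
    (∃ n : ℕ, Even n ∧
      SpectralAction.topSpectrum μ (SpectralAction.lazy (PMF.uniformOfFinset S hne)) ^ n <
        SpectralAction.returnProb (SpectralAction.lazy (PMF.uniformOfFinset S hne)) H n) ∧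
    ∀ n : ℕ,
      SpectralAction.topSpectrum μ (SpectralAction.lazy (PMF.uniformOfFinset S hne)) ^ n <
        SpectralAction.returnProb (SpectralAction.lazy (PMF.uniformOfFinset S hne)) H n →
      ∃ H' : Subgroup Γ,
        H' = SpectralAction.walkSubgroup
          (SpectralAction.lazy (PMF.uniformOfFinset S hne)) H n ∧
        H' ≤ H ∧ H'.FG ∧ SpectralAction.FinitelyManyComponentsWithGap μ H' := by
  have : Countable Γ := SpectralAction.countable_of_closure_eq_top hgen
  have hfin : ∀ n, (SpectralAction.walk (SpectralAction.lazy
      (PMF.uniformOfFinset S hne)) n).support.Finite :=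
    SpectralAction.walk_support_finite (by rw [SpectralAction.lazy_support]; simp)
  refine ⟨?_, fun n hn => ?_⟩
  -- The two bounds combine to `ρ(Γ, H, λ_S) ≤ 2ρ - 1 ≤ ρ⁺(X, λ_S)`, contrary to `hH`.
  · by_contra! hle
    have h1 := SpectralAction.relSpectralRadius_le_of_return_le hne hsymm hgen H
      (SpectralAction.topSpectrum_lazy_nonneg (μ := μ) hne) hle
    have h2 := SpectralAction.topSpectrum_lazy_le (p := PMF.uniformOfFinset S hne)
      fun g : Γ => measurePreserving_smul g μ
    linarith
  · have hTfin := (hfin n).inter_of_right (H : Set Γ)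
    have hT : ∀ g, g ∈ hTfin.toFinset ↔ g ∈ H ∧ g ∈ (SpectralAction.walk (SpectralAction.lazy
        (PMF.uniformOfFinset S hne)) n).support := fun g => by
      rw [Set.Finite.mem_toFinset]
      rfl
    refine ⟨_, rfl, ?_, ⟨hTfin.toFinset, ?_⟩, ?_⟩
    · exact (Subgroup.closure_le H).2 Set.inter_subset_left
    · rw [Set.Finite.coe_toFinset]
      rfl
    -- The nonconcentration constant is `c = λ'_n(H) - ρ ^ n`, positive by `hn`.
    · exact SpectralAction.finitelyManyComponentsWithGap_of_nonconcentration (T := hTfin.toFinset)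
        (fun h hh => Subgroup.subset_closure ((hT h).1 hh)) (sub_pos.2 hn)
        fun v hv hv0 => SpectralAction.sub_mul_integral_sq_le hne hsymm H n hT hv hv0
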